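/- **Definitions.** Let $C\ge 1$, $D\ge 0$. A $(C,D)$-quasi-Leibniz quantum compact metric space is a pair $(\mathfrak A,\mathsf L)$ where $\mathfrak A\neq 0$ is a unital C*-algebra and $\mathsf L$ is a seminorm defined on a dense Jordan–Lie subalgebra $\mathrm{dom}(\mathsf L)$ of the self-adjoint part $\mathfrak{sa}(\mathfrak A)$ (and extended by $\infty$ outside of it) such that: (i) $\mathsf L(a)=0$ if and only if $a\in\mathbb R1_{\mathfrak A}$; (ii) for all $a,b\in\mathrm{dom}(\mathsf L)$, $\max\{\mathsf L(\tfrac{ab+ba}{2}),\mathsf L(\tfrac{ab-ba}{2i})\}\le C(\|a\|\mathsf L(b)+\|b\|\mathsf L(a))+D\,\mathsf L(a)\mathsf L(b)$; (iii) $\mathsf{mk}_{\mathsf L}(\varphi,\psi)=\sup\{|\varphi(a)-\psi(a)|:\mathsf L(a)\le1\}$ is a metric on the state space $\mathscr S(\mathfrak A)$ which induces the weak* topology; (iv) $\mathsf L$ is lower semicontinuous for the norm. A bridge $\gamma=(\mathfrak D,\omega,\pi_{\mathfrak A},\pi_{\mathfrak B})$ from $\mathfrak A$ to $\mathfrak B$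 consists of a unital C*-algebra $\mathfrak D$, unital *-monomorphisms $\pi_{\mathfrak A}:\mathfrak A\to\mathfrak D$, $\pi_{\mathfrak B}:\mathfrak B\to\mathfrak D$, and $\omega\in\mathfrak D$ such that $\mathscr S_1(\mathfrak D|\omega)=\{\varphi\in\mathscr S(\mathfrak D):\varphi((1-\omega)^*(1-\omega))=\varphi((1-\omega)(1-\omega)^*)=0\}$ is not empty. With respect to $\mathsf L_{\mathfrak A},\mathsf L_{\mathfrak B}$, its height is the maximum of the $\mathsf{mk}_{\mathsf L_{\mathfrak A}}$-Hausdorff distance between $\mathscr S(\mathfrak A)$ and $\{\varphi\circ\pi_{\mathfrak A}:\varphi\in\mathscr S_1(\mathfrak D|\omega)\}$ and of the same quantity for $\mathfrak B$; its reach is the Hausdorff distance between $\{a\in\mathfrak{sa}(\mathfrak A):\mathsf L_{\mathfrak A}(a)\le1\}$ and $\{b\in\mathfrak{sa}(\mathfrak B):\mathsf L_{\mathfrak B}(b)\le1\}$, where the distance between $a$ and $b$ is $\|\pi_{\mathfrak A}(a)\omega-\omega\pi_{\mathfrak B}(b)\|_{\mathfrak D}$; its length is the maximum of its height and its reach. The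 quantum propinquity $\mathsf\Lambda$ on the class of $(2,0)$-quasi-Leibniz quantum compact metric spaces is the largest pseudo-distance on this class such that $\mathsf\Lambda((\mathfrak A,\mathsf L_{\mathfrak A}),(\mathfrak B,\mathsf L_{\mathfrak B}))$ is at most the length of every bridge from $\mathfrak A$ to $\mathfrak B$; that is, the infimum of the sums of the lengths of the bridges over all finite chains of bridges, within this class, from $(\mathfrak A,\mathsf L_{\mathfrak A})$ to $(\mathfrak B,\mathsf L_{\mathfrak B})$. **Statement.** Let $\mathcal C=\prod_{n\in\mathbb N}\mathbb Z/2$ be the Cantor set, and let $\lambda$ be the state of $C(\mathcal C)$ (the C*-algebra of complex-valued continuous functions) given by integration against the Haar probability measure. Let $\eta_n(z)=z_n\in\{0,1\}$, $u_n=2\eta_n-1$, and let $\mathfrak A_n$ be the C*-subalgebra of $C(\mathcal C)$ generated by $1,u_0,\dots,u_{n-1}$ (so $\mathfrak A_0=\mathbb C1$). Then, for each $n\in\mathbb N$, there is a unique conditional expectation $\mathbb E(\cdot|\mathfrak A_n)$ of $C(\mathcal C)$ onto $\mathfrak A_n$ (a positive linear map of norm $1$ onto $\mathfrak A_n$ with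 $\mathbb E(bac|\mathfrak A_n)=b\,\mathbb E(a|\mathfrak A_n)c$ for $b,c\in\mathfrak A_n$) such that $\lambda\circ\mathbb E(\cdot|\mathfrak A_n)=\lambda$. For $r>1$ let $\beta_r(n)=\tfrac12r^{-n}$ and, for $a\in\mathfrak{sa}(C(\mathcal C))$, $$\mathsf L_r(a)=\sup_{n\in\mathbb N}\frac{\|a-\mathbb E(a|\mathfrak A_n)\|}{\beta_r(n)}\in[0,\infty].$$ Then $(C(\mathcal C),\mathsf L_r)$ is a $(2,0)$-quasi-Leibniz quantum compact metric space for every $r>1$, and the map $r\in(1,\infty)\mapsto(C(\mathcal C),\mathsf L_r)$ is continuous from $(1,\infty)$ to the class of $(2,0)$-quasi-Leibniz quantum compact metric spaces with the topology of the quantum propinquity $\mathsf\Lambda$. -/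

import Mathlib

open scoped ENNReal NNReal ComplexOrder CStarAlgebra Topology

namespace QuantumMetric

noncomputable section

/-! ### States and the Monge-Kantorovich metric -/

/-- The state space of a unital C*-algebra, as a subspace of the dual with the weak* topology:
unital functionals that are nonnegative on the elements `a* a`. -/
abbrev StateSpace (A : Type) [CStarAlgebra A] : Type :=
  {φ : WeakDual ℂ A // φ 1 = 1 ∧ ∀ a : A, 0 ≤ φ (star a * a)}

/-- The map dual to a unital *-morphism, on states. -/
def pullback {A D : Type} [CStarAlgebra A] [CStarAlgebra D] (π : A →⋆ₐ[ℂ] D)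
    (φ : StateSpace D) : StateSpace A :=
  ⟨StrongDual.toWeakDual
      ((WeakDual.toStrongDual φ.1).comp ⟨π.toAlgHom.toLinearMap, map_continuous π⟩), by
    refine ⟨?_, fun a => ?_⟩
    · change φ.1 (π 1) = 1
      rw [map_one]; exact φ.2.1
    · change 0 ≤ φ.1 (π (star a * a))
      rw [map_mul, map_star]; exact φ.2.2 (π a)⟩

/-- The Monge-Kantorovich distance between two states, for a seminorm `L` on the self-adjoint part
(with the value `∞` outside of its domain). -/
def mkDist {A : Type} [CStarAlgebra A] (L : selfAdjoint A → ℝ≥0∞) (φ ψ : StateSpace A) : ℝ≥0∞ :=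
  ⨆ (a : selfAdjoint A) (_ : L a ≤ 1), ‖φ.1 (a : A) - ψ.1 (a : A)‖ₑ

/-! ### Quasi-Leibniz quantum compact metric spaces -/

/-- The Jordan product `(ab + ba) / 2` of two self-adjoint elements. -/
def jordan {A : Type} [CStarAlgebra A] (a b : selfAdjoint A) : selfAdjoint A :=
  ⟨(1 / 2 : ℂ) • ((a : A) * b + b * a), by
    rw [selfAdjoint.mem_iff, star_smul, star_add, star_mul, star_mul, a.2.star_eq, b.2.star_eq,
      add_comm]
    simp⟩

/-- The Lie product `(ab - ba) / (2i)` of two self-adjoint elements. -/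
def lie {A : Type} [CStarAlgebra A] (a b : selfAdjoint A) : selfAdjoint A :=
  ⟨(1 / (2 * Complex.I) : ℂ) • ((a : A) * b - b * a), by
    rw [selfAdjoint.mem_iff, star_smul, star_sub, star_mul, star_mul, a.2.star_eq, b.2.star_eq,
      ← neg_sub, smul_neg, ← neg_smul]
    simp⟩

/-- `(A, L)` is a `(C, D)`-quasi-Leibniz quantum compact metric space. The seminorm `L` is extended
by `∞` outside of its domain `{a | L a ≠ ∞}`; this domain is a real subspace by
`add_le` and `smul`, and a Jordan-Lie subalgebra by `quasiLeibniz`. -/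
structure IsQQCMS (C D : ℝ≥0) (A : Type) [CStarAlgebra A] (L : selfAdjoint A → ℝ≥0∞) : Prop where
  nontrivial : Nontrivial A
  add_le : ∀ a b, L (a + b) ≤ L a + L b
  smul : ∀ (t : ℝ) a, L (t • a) = ‖t‖ₑ * L a
  dense_domain : Dense {a | L a ≠ ∞}
  eq_zero_iff : ∀ a, L a = 0 ↔ ∃ t : ℝ, a = t • (1 : selfAdjoint A)
  quasiLeibniz : ∀ a b, L a ≠ ∞ → L b ≠ ∞ →
    max (L (jordan a b)) (L (lie a b)) ≤ C * (‖a‖ₑ * L b + ‖b‖ₑ * L a) + D * L a * L b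
  metrizes : ∃ m : MetricSpace (StateSpace A),
    (∀ φ ψ, ENNReal.ofReal (m.dist φ ψ) = mkDist L φ ψ) ∧
      m.toUniformSpace.toTopologicalSpace = instTopologicalSpaceSubtype
  lowerSemicontinuous : LowerSemicontinuous L

/-- The class of `(C, D)`-quasi-Leibniz quantum compact metric spaces. -/
structure QQCMS (C D : ℝ≥0) where
  carrier : Type
  [cstar : CStarAlgebra carrier]
  lip : selfAdjoint carrier → ℝ≥0∞
  isQQCMS : IsQQCMS C D carrier lip

attribute [instance] QQCMS.cstar

/-! ### Bridges -/

/-- The 1-level set of an element `ω`: the states that vanish on `(1-ω)*(1-ω)` and `(1-ω)(1-ω)*`. -/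
def levelSet {D : Type} [CStarAlgebra D] (ω : D) : Set (StateSpace D) :=
  {φ | φ.1 (star (1 - ω) * (1 - ω)) = 0 ∧ φ.1 ((1 - ω) * star (1 - ω)) = 0}

/-- A bridge from `A` to `B`, with its pivot. -/
structure Bridge (A B : Type) [CStarAlgebra A] [CStarAlgebra B] where
  alg : Type
  [cstar : CStarAlgebra alg]
  left : A →⋆ₐ[ℂ] alg
  right : B →⋆ₐ[ℂ] alg
  pivot : alg
  left_injective : Function.Injective left
  right_injective : Function.Injective right
  levelSet_nonempty : (levelSet pivot).Nonempty

attribute [instance] Bridge.cstar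

/-- The Hausdorff distance between `S` and `T`, where `d x y` is the distance from a point of `S`
to a point of `T`. -/
def hausdorff {X Y : Type} (d : X → Y → ℝ≥0∞) (S : Set X) (T : Set Y) : ℝ≥0∞ :=
  max (⨆ x ∈ S, ⨅ y ∈ T, d x y) (⨆ y ∈ T, ⨅ x ∈ S, d x y)

namespace Bridge

variable {A B : Type} [CStarAlgebra A] [CStarAlgebra B]

/-- The height of a bridge. -/
def height (γ : Bridge A B) (LA : selfAdjoint A → ℝ≥0∞) (LB : selfAdjoint B → ℝ≥0∞) : ℝ≥0∞ :=
  max (hausdorff (mkDist LA) Set.univ (pullback γ.left '' levelSet γ.pivot))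
    (hausdorff (mkDist LB) Set.univ (pullback γ.right '' levelSet γ.pivot))

/-- The reach of a bridge: the Hausdorff distance between the unit balls of the two seminorms, for
the bridge seminorm. -/
def reach (γ : Bridge A B) (LA : selfAdjoint A → ℝ≥0∞) (LB : selfAdjoint B → ℝ≥0∞) : ℝ≥0∞ :=
  hausdorff
    (fun (a : selfAdjoint A) (b : selfAdjoint B) =>
      ‖γ.left (a : A) * γ.pivot - γ.pivot * γ.right (b : B)‖ₑ)
    {a | LA a ≤ 1} {b | LB b ≤ 1}

/-- The length of a bridge. -/
def length (γ : Bridge A B) (LA : selfAdjoint A → ℝ≥0∞) (LB : selfAdjoint B → ℝ≥0∞) : ℝ≥0∞ :=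
  max (γ.height LA LB) (γ.reach LA LB)

/-- The identity bridge. -/
def refl (A : Type) [CStarAlgebra A] (h : Nonempty (StateSpace A)) : Bridge A A where
  alg := A
  left := StarAlgHom.id ℂ A
  right := StarAlgHom.id ℂ A
  pivot := 1
  left_injective := fun _ _ h => h
  right_injective := fun _ _ h => h
  levelSet_nonempty := h.elim fun φ => ⟨φ, by simp [levelSet]⟩

/-- The reversed bridge, whose pivot is the adjoint of the pivot. -/
def symm (γ : Bridge A B) : Bridge B A where
  alg := γ.alg
  left := γ.right
  right := γ.left
  pivot := star γ.pivot
  left_injective := γ.right_injective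
  right_injective := γ.left_injective
  levelSet_nonempty := by
    obtain ⟨φ, h1, h2⟩ := γ.levelSet_nonempty
    exact ⟨φ, by simpa [levelSet] using h2, by simpa [levelSet] using h1⟩

end Bridge

/-! ### The quantum propinquity -/

variable {C D : ℝ≥0}

/-- A trek: a finite nonempty chain of bridges between quasi-Leibniz quantum compact metric
spaces, all with the same constants. -/
inductive Trek : QQCMS C D → QQCMS C D → Type 1
  | single {X Y : QQCMS C D} (γ : Bridge X.carrier Y.carrier) : Trek X Y
  | cons {X Y Z : QQCMS C D} (γ : Bridge X.carrier Y.carrier) (t : Trek Y Z) : Trek X Z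

/-- The length of a trek: the sum of the lengths of its bridges. -/
def Trek.length : {X Y : QQCMS C D} → Trek X Y → ℝ≥0∞
  | X, Y, .single γ => γ.length X.lip Y.lip
  | X, _, .cons (Y := Y) γ t => γ.length X.lip Y.lip + t.length

/-- The quantum propinquity: the infimum of the lengths of the treks. -/
def propinquity (X Y : QQCMS C D) : ℝ≥0∞ := ⨅ t : Trek X Y, t.length

theorem propinquity_le_length {X Y : QQCMS C D} (γ : Bridge X.carrier Y.carrier) :
    propinquity X Y ≤ γ.length X.lip Y.lip :=
  iInf_le Trek.length (Trek.single γ)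

/-- The quantum propinquity is the largest function that satisfies the triangle inequality and is
bounded by the lengths of all bridges. -/
theorem le_propinquity (Ξ : QQCMS C D → QQCMS C D → ℝ≥0∞)
    (htri : ∀ X Y Z, Ξ X Z ≤ Ξ X Y + Ξ Y Z)
    (hlen : ∀ (X Y : QQCMS C D) (γ : Bridge X.carrier Y.carrier), Ξ X Y ≤ γ.length X.lip Y.lip)
    (X Y : QQCMS C D) : Ξ X Y ≤ propinquity X Y := by
  refine le_iInf fun t => ?_
  induction t with
  | single γ => exact hlen _ _ γ
  | cons γ t ih => exact (htri _ _ _).trans (add_le_add (hlen _ _ γ) ih)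

theorem propinquity_triangle (X Y Z : QQCMS C D) :
    propinquity X Z ≤ propinquity X Y + propinquity Y Z := by
  refine ENNReal.le_iInf_add_iInf fun s t => ?_
  induction s with
  | single γ => exact iInf_le Trek.length (Trek.cons γ t)
  | @cons X W Y γ s ih =>
    have h : propinquity X Z ≤ γ.length X.lip W.lip + propinquity W Z := by
      conv_rhs => rw [propinquity, ENNReal.add_iInf]
      exact le_iInf fun u => iInf_le Trek.length (Trek.cons γ u)
    refine h.trans ?_
    rw [Trek.length, add_assoc]
    exact add_le_add le_rfl (ih t)

theorem levelSet_star {A : Type} [CStarAlgebra A] (ω : A) : levelSet (star ω) = levelSet ω := by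
  ext φ
  simp only [levelSet, Set.mem_ofPred_eq, star_sub, star_one, star_star]
  exact and_comm

theorem Bridge.symm_length {A B : Type} [CStarAlgebra A] [CStarAlgebra B] (γ : Bridge A B)
    (LA : selfAdjoint A → ℝ≥0∞) (LB : selfAdjoint B → ℝ≥0∞) :
    γ.symm.length LB LA = γ.length LA LB := by
  have hl : levelSet γ.symm.pivot = (levelSet γ.pivot : Set (StateSpace γ.alg)) :=
    levelSet_star γ.pivot
  have hh : γ.symm.height LB LA = γ.height LA LB := by
    unfold Bridge.height
    rw [max_comm]
    exact congrArg (fun S : Set (StateSpace γ.alg) =>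
      max (hausdorff (mkDist LA) Set.univ (pullback γ.left '' S))
        (hausdorff (mkDist LB) Set.univ (pullback γ.right '' S))) hl
  have hr : γ.symm.reach LB LA = γ.reach LA LB := by
    unfold Bridge.reach hausdorff
    have key : ∀ (a : selfAdjoint A) (b : selfAdjoint B),
        ‖γ.symm.left (b : B) * γ.symm.pivot - γ.symm.pivot * γ.symm.right (a : A)‖ₑ =
          ‖γ.left (a : A) * γ.pivot - γ.pivot * γ.right (b : B)‖ₑ := by
      intro a b
      change ‖γ.right (b : B) * star γ.pivot - star γ.pivot * γ.left (a : A)‖ₑ = _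
      have : γ.right (b : B) * star γ.pivot - star γ.pivot * γ.left (a : A) =
          - star (γ.left (a : A) * γ.pivot - γ.pivot * γ.right (b : B)) := by
        rw [star_sub, star_mul, star_mul, ← map_star, ← map_star, a.2.star_eq, b.2.star_eq,
          neg_sub]
      rw [this, enorm_neg, ← ofReal_norm, ← ofReal_norm, norm_star]
    simp only [key]
    rw [max_comm]
  rw [Bridge.length, Bridge.length, hh, hr]

theorem propinquity_symm_le (X Y : QQCMS C D) : propinquity X Y ≤ propinquity Y X :=
  le_propinquity (fun X Y => propinquity Y X)
    (fun X Y Z => (propinquity_triangle Z Y X).trans (add_comm _ _).le)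
    (fun X Y γ => (propinquity_le_length γ.symm).trans (Bridge.symm_length γ X.lip Y.lip).le) Y X

theorem nonempty_stateSpace (A : Type) [CStarAlgebra A] [Nontrivial A] :
    Nonempty (StateSpace A) := by
  obtain ⟨f, hf, h1⟩ := exists_dual_vector' ℂ (1 : A)
  replace h1 : f 1 = 1 := by simpa using h1
  have hle : ∀ a : A, ‖f a‖ ≤ ‖a‖ := fun a => by simpa [hf] using f.le_opNorm a
  have him : ∀ a : A, IsSelfAdjoint a → (f a).im = 0 := by
    intro a ha
    have key : ∀ t : ℝ, ((f a).im + t) ^ 2 ≤ ‖a‖ ^ 2 + t ^ 2 := by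
      intro t
      have e1 : f (a + (t * Complex.I : ℂ) • (1 : A)) = f a + t * Complex.I := by
        rw [map_add, map_smul, h1, smul_eq_mul, mul_one]
      have e2 : star (a + (t * Complex.I : ℂ) • (1 : A)) * (a + (t * Complex.I : ℂ) • (1 : A)) =
          a * a + ((t ^ 2 : ℝ) : ℂ) • (1 : A) := by
        have hs : star (t * Complex.I : ℂ) = -(t * Complex.I) := by simp
        have hI : (t * Complex.I : ℂ) * (t * Complex.I) = -((t ^ 2 : ℝ) : ℂ) := by
          push_cast
          linear_combination (t : ℂ) ^ 2 * Complex.I_mul_I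
        rw [star_add, star_smul, star_one, ha.star_eq, hs, add_mul, mul_add, mul_add, smul_mul_smul,
          neg_mul, hI, neg_neg, mul_one, mul_smul_comm, smul_mul_assoc, one_mul, mul_one, neg_smul]
        abel
      have e3 : ‖a + (t * Complex.I : ℂ) • (1 : A)‖ ^ 2 ≤ ‖a‖ ^ 2 + t ^ 2 := by
        rw [sq, ← CStarRing.norm_star_mul_self, e2]
        refine (norm_add_le _ _).trans (add_le_add ((norm_mul_le _ _).trans (sq _).ge) ?_)
        rw [norm_smul, norm_one, mul_one, Complex.norm_real, Real.norm_of_nonneg (sq_nonneg t)]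
      have e4 : |(f a).im + t| ≤ ‖a + (t * Complex.I : ℂ) • (1 : A)‖ := by
        refine le_trans ?_ (hle _)
        rw [e1]
        simpa using Complex.abs_im_le_norm (f a + t * Complex.I)
      calc ((f a).im + t) ^ 2 = |(f a).im + t| ^ 2 := (sq_abs _).symm
        _ ≤ ‖a + (t * Complex.I : ℂ) • (1 : A)‖ ^ 2 := by gcongr
        _ ≤ _ := e3
    by_contra h0
    have := key ((‖a‖ ^ 2 + 1) / (2 * (f a).im))
    have h2 : 2 * (f a).im * ((‖a‖ ^ 2 + 1) / (2 * (f a).im)) = ‖a‖ ^ 2 + 1 := by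
      field_simp
    nlinarith [sq_nonneg (f a).im]
  refine ⟨⟨StrongDual.toWeakDual f, h1, fun a => ?_⟩⟩
  change 0 ≤ f (star a * a)
  have hsa : IsSelfAdjoint (star a * a) := IsSelfAdjoint.star_mul_self a
  have hn : ‖algebraMap ℝ A ‖star a * a‖₊ - star a * a‖₊ ≤ ‖star a * a‖₊ := by
    rw [← SpectrumRestricts.nnreal_iff_nnnorm hsa le_rfl]
    exact SpectrumRestricts.nnreal_iff.2 spectrum_star_mul_self_nonneg
  have e : f (algebraMap ℝ A ‖star a * a‖₊ - star a * a) =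
      ((‖star a * a‖ : ℝ) : ℂ) - f (star a * a) := by
    rw [map_sub, Algebra.algebraMap_eq_smul_one, coe_nnnorm, ← Complex.coe_smul, map_smul, h1,
      smul_eq_mul, mul_one]
  have h3 : ‖star a * a‖ - (f (star a * a)).re ≤ ‖star a * a‖ := by
    calc ‖star a * a‖ - (f (star a * a)).re
        = (f (algebraMap ℝ A ‖star a * a‖₊ - star a * a)).re := by rw [e]; simp
      _ ≤ ‖f (algebraMap ℝ A ‖star a * a‖₊ - star a * a)‖ := Complex.re_le_norm _
      _ ≤ ‖algebraMap ℝ A ‖star a * a‖₊ - star a * a‖ := hle _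
      _ ≤ ‖star a * a‖ := hn
  rw [Complex.nonneg_iff]
  exact ⟨by linarith, (him _ hsa).symm⟩

theorem propinquity_self (X : QQCMS C D) : propinquity X X = 0 := by
  have := X.isQQCMS.nontrivial
  have hne := nonempty_stateSpace X.carrier
  refine le_antisymm ((propinquity_le_length (Bridge.refl X.carrier hne)).trans ?_) bot_le
  have hmk : ∀ φ : StateSpace X.carrier, mkDist X.lip φ φ = 0 := by simp [mkDist]
  have hu : (pullback (StarAlgHom.id ℂ X.carrier) '' levelSet (1 : X.carrier)) = Set.univ := by
    refine Set.eq_univ_of_forall fun φ => ⟨φ, by simp [levelSet], rfl⟩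
  have hd : ∀ {Z : Type} (d : Z → Z → ℝ≥0∞) (S : Set Z), (∀ z, d z z = 0) →
      hausdorff d S S = 0 := by
    intro Z d S hz
    refine le_antisymm (max_le ?_ ?_) bot_le <;>
      exact iSup₂_le fun z hzS => (iInf₂_le z hzS).trans (hz z).le
  refine max_le (max_le ?_ ?_) ?_
  · change hausdorff (mkDist X.lip) Set.univ
      (pullback (StarAlgHom.id ℂ X.carrier) '' levelSet (1 : X.carrier)) ≤ 0
    rw [hu, hd _ _ hmk]
  · change hausdorff (mkDist X.lip) Set.univ
      (pullback (StarAlgHom.id ℂ X.carrier) '' levelSet (1 : X.carrier)) ≤ 0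
    rw [hu, hd _ _ hmk]
  · refine (hd _ _ fun a => ?_).le
    change ‖(a : X.carrier) * 1 - 1 * (a : X.carrier)‖ₑ = 0
    simp

/-- The class of quasi-Leibniz quantum compact metric spaces, with the (extended pseudo-)metric
given by the quantum propinquity and the topology it induces. -/
instance : PseudoEMetricSpace (QQCMS C D) where
  edist := propinquity
  edist_self := propinquity_self
  edist_comm X Y := le_antisymm (propinquity_symm_le X Y) (propinquity_symm_le Y X)
  edist_triangle := propinquity_triangle

/-! ### Lip-norms from conditional expectations -/

/-- `E` is a conditional expectation of `A` onto the C*-subalgebra `B` which preserves `μ`. -/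
structure IsCondExp {A : Type} [CStarAlgebra A] (μ : StateSpace A) (B : StarSubalgebra ℂ A)
    (E : A →L[ℂ] A) : Prop where
  range_eq : Set.range E = B
  positive : ∀ a : A, ∃ c : A, E (star a * a) = star c * c
  norm_eq_one : ‖E‖ = 1
  bimodule : ∀ b ∈ B, ∀ c ∈ B, ∀ a : A, E (b * a * c) = b * E a * c
  preserves : ∀ a : A, μ.1 (E a) = μ.1 a

/-- The conditional expectation of `A` onto `B` which preserves `μ` (where there is one). -/
def condExpOnto {A : Type} [CStarAlgebra A] (μ : StateSpace A) (B : StarSubalgebra ℂ A) :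
    A →L[ℂ] A :=
  Classical.epsilon (IsCondExp μ B)

/-- The seminorm `a ↦ sup_n ‖a - E(a | S n)‖ / β n` on the self-adjoint part of `A`, for a sequence
of C*-subalgebras `S n` of `A`, a state `μ` and a sequence `β` of positive numbers. -/
def afLip {A : Type} [CStarAlgebra A] (S : ℕ → StarSubalgebra ℂ A) (μ : StateSpace A) (β : ℕ → ℝ)
    (a : selfAdjoint A) : ℝ≥0∞ :=
  ⨆ n, ‖(a : A) - condExpOnto μ (S n) (a : A)‖ₑ / ENNReal.ofReal (β n)

/-! ### The Cantor set -/

/-- The Cantor set, as a compact group. -/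
abbrev Cantor : Type := ℕ → ZMod 2

/-- The Haar probability measure of the Cantor set. -/
def cantorHaar : MeasureTheory.Measure Cantor := MeasureTheory.Measure.addHaarMeasure ⊤

instance : MeasureTheory.IsProbabilityMeasure cantorHaar :=
  ⟨MeasureTheory.Measure.addHaarMeasure_self (K₀ := (⊤ : TopologicalSpace.PositiveCompacts Cantor))⟩

theorem integrable_cantor (f : C(Cantor, ℂ)) : MeasureTheory.Integrable f cantorHaar :=
  f.continuous.integrable_of_hasCompactSupport (HasCompactSupport.of_compactSpace _)

/-- Integration against the Haar probability measure, a state on `C(Cantor)`. -/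
def cantorTrace : StateSpace C(Cantor, ℂ) :=
  ⟨StrongDual.toWeakDual (LinearMap.mkContinuous
      { toFun := fun f => ∫ x, f x ∂cantorHaar
        map_add' := fun f g => MeasureTheory.integral_add (integrable_cantor f) (integrable_cantor g)
        map_smul' := fun c f => MeasureTheory.integral_smul c f } 1 fun f => by
      refine (MeasureTheory.norm_integral_le_of_norm_le_const
        (Filter.Eventually.of_forall fun x => f.norm_coe_le_norm x)).trans ?_
      simp), by
    refine ⟨?_, fun f => ?_⟩
    · change ∫ x, (1 : C(Cantor, ℂ)) x ∂cantorHaar = 1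
      simp
    · change 0 ≤ ∫ x, (star f * f) x ∂cantorHaar
      refine MeasureTheory.integral_nonneg fun x => ?_
      exact star_mul_self_nonneg (f x)⟩

/-- The evaluation map `η_n`, as a continuous function with values in `{0, 1} ⊆ ℂ`. -/
def cantorEval (n : ℕ) : C(Cantor, ℂ) :=
  ⟨fun z => ((z n).val : ℂ), 
    (continuous_of_discreteTopology (f := fun t : ZMod 2 => (t.val : ℂ))).comp
      (continuous_apply n)⟩

/-- The C*-subalgebra of `C(Cantor)` generated by `1` and `u_j = 2 η_j - 1` for `j < n`. -/
def cantorAlg (n : ℕ) : StarSubalgebra ℂ C(Cantor, ℂ) :=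
  (StarAlgebra.adjoin ℂ {f | ∃ j < n, f = 2 * cantorEval j - 1}).topologicalClosure

/-- The sequence `β_r(n) = r⁻ⁿ / 2`. -/
def cantorBeta (r : ℝ) (n : ℕ) : ℝ := r ^ (-(n : ℤ)) / 2

/-- The Lip-norm on `C(Cantor)` given by `β_r`, the subalgebras above, and the Haar trace. -/
def cantorLip (r : ℝ) : selfAdjoint C(Cantor, ℂ) → ℝ≥0∞ :=
  afLip cantorAlg cantorTrace (cantorBeta r)

end

end QuantumMetric

open QuantumMetric

namespace QuantumMetric

open MeasureTheory Filter

/-! ### The conditional expectations of the Cantor set -/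

/-! The algebra `cantorAlg n` consists exactly of the continuous functions of the first `n`
coordinates (`mem_cantorAlg_iff`), and averaging over the other coordinates, `cantorExp n`, is a
conditional expectation onto it by translation invariance of Haar measure. It is the only one
preserving the Haar state, because that state is faithful (`IsCondExp.eq_cantorExp`). The seminorm
`cantorLip r` thus becomes concrete: it is built from commuting contractions that converge strongly
to the identity.

Modulo scalars, an element of its unit ball has norm at most `1/2` and lies within `cantorBeta r n`
of a finite-dimensional algebra spanned by indicators of cylinders. Finitely many evaluations
therefore control the Monge-Kantorovich distance (`mkDist_cantorLip_le`); density of the domain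
gives the converse comparison with the weak* topology.

For continuity in `r`, the algebra never changes, so the identity bridge is available. Its height is
zero and its length is the Hausdorff distance between the two unit balls. If `r ≤ s`, the `s`-ball
lies in the `r`-ball. Conversely, for `a` in the `r`-ball, `cantorExp N a` has `s`-seminorm at most
`(s/r)^N`; contracting it towards the mean of `a` by `(r/s)^N` lands in the `s`-ball, at distance at
most `cantorBeta r N + (1 - (r/s)^N)` from `a` (`exists_cantorLip_le_one_norm_sub_le`). Taking `N`
large, then `r` and `s` close, makes this small. -/

instance : cantorHaar.IsAddHaarMeasure :=
  inferInstanceAs (Measure.addHaarMeasure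
    (⊤ : TopologicalSpace.PositiveCompacts Cantor)).IsAddHaarMeasure

/-- The element of the Cantor set obtained by erasing the first `n` coordinates. -/
def cantorTail (n : ℕ) (w : Cantor) : Cantor := fun j => if j < n then 0 else w j

theorem cantorTail_add (n : ℕ) (v w : Cantor) :
    cantorTail n (v + w) = cantorTail n v + cantorTail n w := by
  funext j
  by_cases h : j < n <;> simp [cantorTail, h]

theorem continuous_cantorTail (n : ℕ) : Continuous (cantorTail n) := by
  refine continuous_pi fun j => ?_
  by_cases h : j < n <;> simp only [cantorTail, h, if_true, if_false] <;> fun_prop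

theorem add_cantorTail_apply {n j : ℕ} (h : j < n) (z w : Cantor) :
    (z + cantorTail n w) j = z j := by
  simp [cantorTail, h]

theorem integrable_add_cantorTail (n : ℕ) (f : C(Cantor, ℂ)) (z : Cantor) :
    Integrable (fun w => f (z + cantorTail n w)) cantorHaar :=
  integrable_cantor ⟨fun w => f (z + cantorTail n w),
    f.continuous.comp (continuous_const.add (continuous_cantorTail n))⟩

/-- The average of a continuous function over all coordinates but the first `n`. -/
noncomputable def cantorAverage (n : ℕ) (f : C(Cantor, ℂ)) : C(Cantor, ℂ) where
  toFun z := ∫ w, f (z + cantorTail n w) ∂cantorHaar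
  continuous_toFun := by
    refine continuous_of_dominated (bound := fun _ => ‖f‖)
      (fun z => (integrable_add_cantorTail n f z).aestronglyMeasurable)
      (fun z => Eventually.of_forall fun w => f.norm_coe_le_norm _) (integrable_const _)
      (Eventually.of_forall fun w => f.continuous.comp (continuous_id.add continuous_const))

/-- The conditional expectation of `C(Cantor)` onto the functions of the first `n` coordinates. -/
noncomputable def cantorExp (n : ℕ) : C(Cantor, ℂ) →L[ℂ] C(Cantor, ℂ) :=
  LinearMap.mkContinuous
    { toFun := cantorAverage n
      map_add' := fun f g => by
        ext z
        exact integral_add (integrable_add_cantorTail n f z) (integrable_add_cantorTail n g z)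
      map_smul' := fun c f => by
        ext z
        exact integral_smul c _ } 1 fun f => by
      rw [one_mul]
      refine (ContinuousMap.norm_le _ (norm_nonneg f)).2 fun z => ?_
      refine (norm_integral_le_of_norm_le_const
        (Eventually.of_forall fun w => f.norm_coe_le_norm (z + cantorTail n w))).trans ?_
      simp

theorem cantorExp_apply (n : ℕ) (f : C(Cantor, ℂ)) (z : Cantor) :
    cantorExp n f z = ∫ w, f (z + cantorTail n w) ∂cantorHaar := rfl

theorem norm_cantorExp_le (n : ℕ) (f : C(Cantor, ℂ)) : ‖cantorExp n f‖ ≤ ‖f‖ := by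
  simpa using (cantorExp n).le_of_opNorm_le (LinearMap.mkContinuous_norm_le _ zero_le_one _) f

/-- Changing `z` beyond the first `n` coordinates translates the integration variable, which Haar
measure does not see. -/
theorem dependsOn_cantorExp (n : ℕ) (f : C(Cantor, ℂ)) :
    DependsOn (cantorExp n f) (Set.Iio n) := by
  intro z z' h
  have hz : z = z' + cantorTail n (z - z') := by
    funext j
    by_cases hj : j < n
    · simpa [cantorTail, hj] using h j hj
    · simp [cantorTail, hj]
  rw [cantorExp_apply, cantorExp_apply,
    ← integral_add_left_eq_self (fun w => f (z' + cantorTail n w)) (z - z')]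
  refine integral_congr_ae (Eventually.of_forall fun w => ?_)
  change f (z + cantorTail n w) = f (z' + cantorTail n (z - z' + w))
  rw [cantorTail_add, ← add_assoc, ← hz]

/-- The average moves only coordinates that `b` ignores, so `b` is a constant factor under the
integral. -/
theorem cantorExp_mul_of_dependsOn {n : ℕ} {b : C(Cantor, ℂ)} (hb : DependsOn b (Set.Iio n))
    (a : C(Cantor, ℂ)) : cantorExp n (b * a) = b * cantorExp n a := by
  ext z
  rw [ContinuousMap.mul_apply, cantorExp_apply, cantorExp_apply, ← integral_const_mul]
  refine integral_congr_ae (Eventually.of_forall fun w => ?_)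
  change b (z + cantorTail n w) * _ = _
  rw [hb fun j hj => add_cantorTail_apply hj z w]

theorem cantorExp_one (n : ℕ) : cantorExp n 1 = 1 := by
  ext z
  simp [cantorExp_apply]

theorem cantorExp_of_dependsOn {n : ℕ} {b : C(Cantor, ℂ)} (hb : DependsOn b (Set.Iio n)) :
    cantorExp n b = b := by
  simpa [cantorExp_one] using cantorExp_mul_of_dependsOn hb 1

theorem cantorExp_star (n : ℕ) (f : C(Cantor, ℂ)) :
    cantorExp n (star f) = star (cantorExp n f) := by
  ext z
  exact integral_conj

theorem cantorExp_cantorExp_of_le {m n : ℕ} (h : m ≤ n) (f : C(Cantor, ℂ)) :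
    cantorExp n (cantorExp m f) = cantorExp m f :=
  cantorExp_of_dependsOn ((dependsOn_cantorExp m f).mono (Set.Iio_subset_Iio h))

theorem cantorExp_comm (m n : ℕ) (f : C(Cantor, ℂ)) :
    cantorExp m (cantorExp n f) = cantorExp n (cantorExp m f) := by
  ext z
  simp only [cantorExp_apply]
  have hc : Continuous (Function.uncurry fun v w : Cantor =>
      f (z + cantorTail m v + cantorTail n w)) :=
    f.continuous.comp ((continuous_const.add ((continuous_cantorTail m).comp continuous_fst)).add
      ((continuous_cantorTail n).comp continuous_snd))
  rw [integral_integral_swap_of_hasCompactSupport hc (HasCompactSupport.of_compactSpace _)]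
  simp only [add_right_comm]

/-- Fubini, then translation invariance in `z` for each fixed `w`. -/
theorem integral_cantorExp (n : ℕ) (f : C(Cantor, ℂ)) :
    ∫ z, cantorExp n f z ∂cantorHaar = ∫ z, f z ∂cantorHaar := by
  simp only [cantorExp_apply]
  have hc : Continuous (Function.uncurry fun z w : Cantor => f (z + cantorTail n w)) :=
    f.continuous.comp (continuous_fst.add ((continuous_cantorTail n).comp continuous_snd))
  rw [integral_integral_swap_of_hasCompactSupport hc (HasCompactSupport.of_compactSpace _)]
  simp only [integral_add_right_eq_self (fun z => f z)]
  simp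

/-! ### The subalgebras as functions of the first coordinates -/

/-- Functions of the first `n` coordinates form a closed star subalgebra that contains the
generators. -/
theorem dependsOn_of_mem_cantorAlg {n : ℕ} {f : C(Cantor, ℂ)} (hf : f ∈ cantorAlg n) :
    DependsOn f (Set.Iio n) := by
  let S : StarSubalgebra ℂ C(Cantor, ℂ) :=
    { carrier := {f | DependsOn f (Set.Iio n)}
      mul_mem' := fun {f g} hf hg z w h => by
        rw [ContinuousMap.mul_apply, ContinuousMap.mul_apply, hf h, hg h]
      add_mem' := fun {f g} hf hg z w h => by
        rw [ContinuousMap.add_apply, ContinuousMap.add_apply, hf h, hg h]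
      algebraMap_mem' := fun c z w h => rfl
      star_mem' := fun {f} hf z w h => by
        rw [ContinuousMap.star_apply, ContinuousMap.star_apply, hf h] }
  have hS : IsClosed (S : Set C(Cantor, ℂ)) := by
    have : (S : Set C(Cantor, ℂ)) =
        ⋂ (z : Cantor) (w : Cantor) (_ : ∀ j ∈ Set.Iio n, z j = w j), {f | f z = f w} := by
      ext f
      simp only [Set.mem_iInter]
      exact Iff.rfl
    rw [this]
    exact isClosed_iInter fun z => isClosed_iInter fun w => isClosed_iInter fun _ =>
      isClosed_eq (continuous_eval_const z) (continuous_eval_const w)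
  have hle : cantorAlg n ≤ S := by
    refine StarSubalgebra.topologicalClosure_minimal (StarAlgebra.adjoin_le ?_) hS
    rintro _ ⟨j, hj, rfl⟩ z w h
    have := h j hj
    simp [two_mul, cantorEval, this]
  exact hle hf

/-- Induction on `n`: with `η = cantorEval n`, a function of `n + 1` coordinates equals `f₀ (1 - η)
+ f₁ η`, where `fₜ` freezes coordinate `n` at `t` and so depends only on the first `n`. -/
theorem mem_cantorAlg_of_dependsOn {n : ℕ} {f : C(Cantor, ℂ)} (hf : DependsOn f (Set.Iio n)) :
    f ∈ cantorAlg n := by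
  induction n generalizing f with
  | zero =>
    have : f = algebraMap ℂ C(Cantor, ℂ) (f 0) := by
      ext z
      exact hf fun j hj => absurd hj (Nat.not_lt_zero j)
    rw [this]
    exact algebraMap_mem _ _
  | succ n ih =>
    have hmono : cantorAlg n ≤ cantorAlg (n + 1) :=
      StarSubalgebra.topologicalClosure_mono (StarAlgebra.adjoin_mono
        fun g ⟨j, hj, hg⟩ => ⟨j, hj.trans n.lt_succ_self, hg⟩)
    have hc : ∀ t : ZMod 2, Continuous fun z : Cantor => Function.update z n t := fun t =>
      continuous_id.update n continuous_const
    have hg : ∀ t : ZMod 2, (⟨fun z => f (Function.update z n t), f.continuous.comp (hc t)⟩ :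
        C(Cantor, ℂ)) ∈ cantorAlg (n + 1) := by
      refine fun t => hmono (ih fun z w h => hf fun j hj => ?_)
      rcases eq_or_ne j n with rfl | hne
      · simp
      · rw [Function.update_of_ne hne, Function.update_of_ne hne]
        exact h j (lt_of_le_of_ne (Nat.lt_succ_iff.1 hj) hne)
    have hu : 2 * cantorEval n - 1 ∈ cantorAlg (n + 1) :=
      StarSubalgebra.le_topologicalClosure _
        (StarAlgebra.subset_adjoin ℂ _ ⟨n, n.lt_succ_self, rfl⟩)
    have he : cantorEval n ∈ cantorAlg (n + 1) := by
      have : cantorEval n = (1 / 2 : ℂ) • ((2 * cantorEval n - 1) + 1) := by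
        rw [sub_add_cancel, two_mul, ← two_smul ℂ (cantorEval n), smul_smul]
        norm_num
      rw [this]
      exact SMulMemClass.smul_mem _ (add_mem hu (one_mem _))
    have hf' : f = ⟨fun z => f (Function.update z n 0), f.continuous.comp (hc 0)⟩ *
        (1 - cantorEval n) + ⟨fun z => f (Function.update z n 1), f.continuous.comp (hc 1)⟩ *
        cantorEval n := by
      ext z
      have h01 : ∀ t : ZMod 2, t = 0 ∨ t = 1 := by decide
      have hz := Function.update_eq_self n z
      rcases h01 (z n) with h | h <;> rw [h] at hz <;>
        simp [cantorEval, h, hz, ZMod.val_one, -ZMod.natCast_val]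
    rw [hf']
    exact add_mem (mul_mem (hg 0) (sub_mem (one_mem _) he)) (mul_mem (hg 1) he)

theorem mem_cantorAlg_iff {n : ℕ} {f : C(Cantor, ℂ)} :
    f ∈ cantorAlg n ↔ DependsOn f (Set.Iio n) :=
  ⟨dependsOn_of_mem_cantorAlg, mem_cantorAlg_of_dependsOn⟩

/-! ### Existence and uniqueness of the conditional expectations. -/

theorem cantorTrace_apply (f : C(Cantor, ℂ)) : cantorTrace.1 f = ∫ z, f z ∂cantorHaar := rfl

/-- The Haar state is faithful. -/
theorem eq_zero_of_cantorTrace_star_mul_self {f : C(Cantor, ℂ)}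
    (h : cantorTrace.1 (star f * f) = 0) : f = 0 := by
  have e : (fun z => (star f * f) z) = fun z => ((‖f z‖ ^ 2 : ℝ) : ℂ) := by
    funext z
    rw [ContinuousMap.mul_apply, ContinuousMap.star_apply, ← starRingEnd_apply, Complex.conj_mul']
    push_cast
    rfl
  have h' : ∫ z, ‖f z‖ ^ 2 ∂cantorHaar = 0 := by
    rw [cantorTrace_apply, e, integral_complex_ofReal] at h
    exact_mod_cast h
  have hc : Continuous fun z => ‖f z‖ ^ 2 := by fun_prop
  have hi : Integrable (fun z => ‖f z‖ ^ 2) cantorHaar :=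
    hc.integrable_of_hasCompactSupport (HasCompactSupport.of_compactSpace _)
  -- Vanishing almost everywhere gives vanishing everywhere, since Haar measure charges every
  -- nonempty open set.
  rw [integral_eq_zero_iff_of_nonneg (fun z => sq_nonneg _) hi,
    hc.ae_eq_iff_eq cantorHaar (g := 0) continuous_const] at h'
  ext z
  simpa using congrFun h' z

theorem isCondExp_cantorExp (n : ℕ) : IsCondExp cantorTrace (cantorAlg n) (cantorExp n) where
  range_eq := by
    ext f
    refine ⟨?_, fun hf => ⟨f, cantorExp_of_dependsOn (mem_cantorAlg_iff.1 hf)⟩⟩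
    rintro ⟨a, rfl⟩
    exact mem_cantorAlg_iff.2 (dependsOn_cantorExp n a)
  positive a := by
    have key : ∀ z, cantorExp n (star a * a) z =
        ((∫ w, ‖a (z + cantorTail n w)‖ ^ 2 ∂cantorHaar : ℝ) : ℂ) := by
      intro z
      rw [cantorExp_apply, ← integral_complex_ofReal]
      refine integral_congr_ae (Eventually.of_forall fun w => ?_)
      simp only [ContinuousMap.mul_apply, ContinuousMap.star_apply]
      rw [← starRingEnd_apply, Complex.conj_mul']
      push_cast
      rfl
    -- The pointwise square root works because `key` shows the average to be real and nonnegative.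
    refine ⟨⟨fun z => (Real.sqrt (cantorExp n (star a * a) z).re : ℂ), by fun_prop⟩, ?_⟩
    ext z
    have h0 : 0 ≤ (cantorExp n (star a * a) z).re := by
      rw [key, Complex.ofReal_re]
      exact integral_nonneg fun w => sq_nonneg _
    rw [ContinuousMap.mul_apply, ContinuousMap.star_apply]
    simp only [ContinuousMap.coe_mk, RCLike.star_def, Complex.conj_ofReal]
    rw [← Complex.ofReal_mul, Real.mul_self_sqrt h0, key, Complex.ofReal_re]
  norm_eq_one := by
    refine le_antisymm (LinearMap.mkContinuous_norm_le _ zero_le_one _) ?_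
    have := (cantorExp n).le_opNorm 1
    rwa [cantorExp_one, norm_one, mul_one] at this
  bimodule b hb c hc a := by
    rw [mul_comm (b * a) c, cantorExp_mul_of_dependsOn (mem_cantorAlg_iff.1 hc),
      cantorExp_mul_of_dependsOn (mem_cantorAlg_iff.1 hb), mul_comm c]
  preserves a := integral_cantorExp n a

/-- Any such expectation is the orthogonal projection for the inner product of the Haar state: `a -
E a` is orthogonal to the subalgebra. Testing the difference of two candidates against its own
adjoint, which lies in the subalgebra, and using faithfulness makes it zero. -/
theorem IsCondExp.eq_cantorExp {n : ℕ} {E : C(Cantor, ℂ) →L[ℂ] C(Cantor, ℂ)}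
    (hE : IsCondExp cantorTrace (cantorAlg n) E) : E = cantorExp n := by
  have key : ∀ {F : C(Cantor, ℂ) →L[ℂ] C(Cantor, ℂ)}, IsCondExp cantorTrace (cantorAlg n) F →
      ∀ a, F a ∈ cantorAlg n ∧ ∀ b ∈ cantorAlg n,
        cantorTrace.1 (b * F a) = cantorTrace.1 (b * a) := by
    intro F hF a
    refine ⟨?_, fun b hb => ?_⟩
    · rw [← SetLike.mem_coe, ← hF.range_eq]
      exact ⟨a, rfl⟩
    · have := hF.bimodule b hb 1 (one_mem _) a
      rw [mul_one, mul_one] at this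
      rw [← this, hF.preserves]
  ext1 a
  obtain ⟨h1, h2⟩ := key hE a
  obtain ⟨h3, h4⟩ := key (isCondExp_cantorExp n) a
  have hm : star (E a - cantorExp n a) ∈ cantorAlg n := star_mem (sub_mem h1 h3)
  refine sub_eq_zero.1 (eq_zero_of_cantorTrace_star_mul_self ?_)
  rw [mul_sub, map_sub, h2 _ hm, h4 _ hm, sub_self]

theorem condExpOnto_cantorAlg (n : ℕ) :
    condExpOnto cantorTrace (cantorAlg n) = cantorExp n :=
  IsCondExp.eq_cantorExp (Classical.epsilon_spec ⟨_, isCondExp_cantorExp n⟩)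

/-- Uniform continuity of `f`: translates of `f` by `w` are uniformly close to `f` for `w` near `0`,
and a basic neighbourhood of `0` restricts finitely many coordinates, all erased by `cantorTail n`
for large `n`. -/
theorem tendsto_cantorExp (f : C(Cantor, ℂ)) :
    Tendsto (fun n => cantorExp n f) atTop (𝓝 f) := by
  rw [Metric.tendsto_atTop]
  intro ε hε
  let F : C(Cantor, C(Cantor, ℂ)) :=
    ContinuousMap.curry ⟨fun p : Cantor × Cantor => f (p.2 + p.1), by fun_prop⟩
  have hF : {w | dist (F w) (F 0) < ε / 2} ∈ 𝓝 (0 : Cantor) :=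
    F.continuous.continuousAt.eventually (Metric.ball_mem_nhds (F 0) (half_pos hε))
  rw [nhds_pi, Filter.mem_pi] at hF
  obtain ⟨I, hI, t, ht, hsub⟩ := hF
  obtain ⟨N, hN⟩ := hI.bddAbove
  refine ⟨N + 1, fun n hn => ?_⟩
  have hw : ∀ w z, ‖f (z + cantorTail n w) - f z‖ ≤ ε / 2 := by
    intro w z
    have hmem : cantorTail n w ∈ I.pi t := by
      intro j hj
      have : j < n := (Nat.lt_succ_iff.2 (hN hj)).trans_le hn
      simp only [cantorTail, this, if_true]
      exact mem_of_mem_nhds (ht j)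
    have h1 : dist (F (cantorTail n w)) (F 0) < ε / 2 := hsub hmem
    have h2 := (ContinuousMap.dist_apply_le_dist (f := F (cantorTail n w)) (g := F 0) z).trans h1.le
    rw [dist_eq_norm] at h2
    simpa [F] using h2
  refine lt_of_le_of_lt ?_ (half_lt_self hε)
  rw [dist_eq_norm, ContinuousMap.norm_le _ (half_pos hε).le]
  intro z
  have e : (cantorExp n f - f) z = ∫ w, (f (z + cantorTail n w) - f z) ∂cantorHaar := by
    rw [integral_sub (integrable_add_cantorTail n f z) (integrable_const _)]
    simp [cantorExp_apply]
  rw [e]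
  refine (norm_integral_le_of_norm_le_const (Eventually.of_forall fun w => hw w z)).trans ?_
  simp

/-! ### The Lip-norms -/

theorem cantorBeta_pos {r : ℝ} (hr : 0 < r) (n : ℕ) : 0 < cantorBeta r n :=
  half_pos (zpow_pos hr _)

theorem cantorBeta_eq (r : ℝ) (n : ℕ) : cantorBeta r n = r⁻¹ ^ n / 2 := by
  rw [cantorBeta, zpow_neg, zpow_natCast, inv_pow]

theorem cantorBeta_zero (r : ℝ) : cantorBeta r 0 = 1 / 2 := by
  simp [cantorBeta]

theorem tendsto_cantorBeta {r : ℝ} (hr : 1 < r) : Tendsto (cantorBeta r) atTop (𝓝 0) := by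
  have : Tendsto (fun n => r⁻¹ ^ n / 2) atTop (𝓝 (0 / 2)) :=
    (tendsto_pow_atTop_nhds_zero_of_lt_one (by positivity) (inv_lt_one_of_one_lt₀ hr)).div_const 2
  rw [zero_div] at this
  exact this.congr fun n => (cantorBeta_eq r n).symm

theorem cantorLip_eq (r : ℝ) (a : selfAdjoint C(Cantor, ℂ)) :
    cantorLip r a =
      ⨆ n, ‖(a : C(Cantor, ℂ)) - cantorExp n (a : C(Cantor, ℂ))‖ₑ / ENNReal.ofReal (cantorBeta r n) := by
  simp only [cantorLip, afLip, condExpOnto_cantorAlg]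

theorem cantorLip_le_ofReal_iff {r t : ℝ} (hr : 0 < r) (ht : 0 ≤ t)
    (a : selfAdjoint C(Cantor, ℂ)) :
    cantorLip r a ≤ ENNReal.ofReal t ↔
      ∀ n, ‖(a : C(Cantor, ℂ)) - cantorExp n (a : C(Cantor, ℂ))‖ ≤ t * cantorBeta r n := by
  rw [cantorLip_eq, iSup_le_iff]
  refine forall_congr' fun n => ?_
  have hb := cantorBeta_pos hr n
  rw [ENNReal.div_le_iff (by simpa using hb) ENNReal.ofReal_ne_top, ← ENNReal.ofReal_mul ht,
    ← ofReal_norm, ENNReal.ofReal_le_ofReal_iff (by positivity)]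

theorem cantorLip_le_one_iff {r : ℝ} (hr : 0 < r) (a : selfAdjoint C(Cantor, ℂ)) :
    cantorLip r a ≤ 1 ↔
      ∀ n, ‖(a : C(Cantor, ℂ)) - cantorExp n (a : C(Cantor, ℂ))‖ ≤ cantorBeta r n := by
  simpa using cantorLip_le_ofReal_iff hr zero_le_one a

/-- The conditional expectation on the self-adjoint part. -/
noncomputable def cantorExpSelfAdjoint (n : ℕ) (a : selfAdjoint C(Cantor, ℂ)) :
    selfAdjoint C(Cantor, ℂ) :=
  ⟨cantorExp n (a : C(Cantor, ℂ)), by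
    rw [selfAdjoint.mem_iff, ← cantorExp_star, a.2.star_eq]⟩

theorem coe_cantorExpSelfAdjoint (n : ℕ) (a : selfAdjoint C(Cantor, ℂ)) :
    (cantorExpSelfAdjoint n a : C(Cantor, ℂ)) = cantorExp n (a : C(Cantor, ℂ)) := rfl

theorem cantorExp_zero_eq_smul_one (a : selfAdjoint C(Cantor, ℂ)) :
    ∃ t : ℝ, cantorExpSelfAdjoint 0 a = t • (1 : selfAdjoint C(Cantor, ℂ)) := by
  refine ⟨(cantorExp 0 (a : C(Cantor, ℂ)) 0).re, ?_⟩
  have hre : ((cantorExp 0 (a : C(Cantor, ℂ)) 0).re : ℂ) = cantorExp 0 (a : C(Cantor, ℂ)) 0 := by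
    have h := congrArg (fun f : C(Cantor, ℂ) => f 0) (cantorExpSelfAdjoint 0 a).2.star_eq
    exact Complex.conj_eq_iff_re.1 h
  ext z
  change cantorExp 0 (a : C(Cantor, ℂ)) z = _
  rw [dependsOn_cantorExp 0 _ (fun j hj => absurd hj (Nat.not_lt_zero j)) (y := 0), ← hre]
  simp

theorem cantorLip_add_le (r : ℝ) (a b : selfAdjoint C(Cantor, ℂ)) :
    cantorLip r (a + b) ≤ cantorLip r a + cantorLip r b := by
  simp only [cantorLip_eq]
  refine iSup_le fun n => ?_
  refine le_trans ?_ (add_le_add (le_iSup _ n) (le_iSup _ n))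
  rw [← ENNReal.add_div, AddSubgroup.coe_add, map_add, add_sub_add_comm]
  exact ENNReal.div_le_div_right (enorm_add_le _ _) _

theorem cantorLip_smul (r : ℝ) (t : ℝ) (a : selfAdjoint C(Cantor, ℂ)) :
    cantorLip r (t • a) = ‖t‖ₑ * cantorLip r a := by
  simp only [cantorLip_eq]
  rw [ENNReal.mul_iSup]
  refine iSup_congr fun n => ?_
  have e : ((t • a : selfAdjoint C(Cantor, ℂ)) : C(Cantor, ℂ)) = (t : ℂ) • (a : C(Cantor, ℂ)) := rfl
  rw [e, map_smul, ← smul_sub, enorm_smul, mul_div_assoc]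
  congr 1
  rw [← ofReal_norm, ← ofReal_norm, Complex.norm_real]

theorem cantorLip_smul_one {r : ℝ} (hr : 0 < r) (t : ℝ) :
    cantorLip r (t • (1 : selfAdjoint C(Cantor, ℂ))) = 0 := by
  have h1 : cantorLip r (1 : selfAdjoint C(Cantor, ℂ)) = 0 := by
    refine le_antisymm ?_ bot_le
    simpa using (cantorLip_le_ofReal_iff hr le_rfl 1).2 fun n => by simp [cantorExp_one]
  rw [cantorLip_smul, h1, mul_zero]

theorem cantorLip_eq_zero_iff {r : ℝ} (hr : 0 < r) (a : selfAdjoint C(Cantor, ℂ)) :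
    cantorLip r a = 0 ↔ ∃ t : ℝ, a = t • (1 : selfAdjoint C(Cantor, ℂ)) := by
  constructor
  · intro h
    have h0 := (cantorLip_le_ofReal_iff hr le_rfl a).1 (by simp [h]) 0
    rw [zero_mul, norm_le_zero_iff, sub_eq_zero] at h0
    obtain ⟨t, ht⟩ := cantorExp_zero_eq_smul_one a
    exact ⟨t, by rw [← ht]; exact Subtype.ext h0⟩
  · rintro ⟨t, rfl⟩
    exact cantorLip_smul_one hr t

/-- The `L_s` seminorm of the conditional expectation of an element of the `L_r` unit ball. -/
theorem cantorLip_cantorExp_le {r s : ℝ} (hr : 0 < r) (hrs : r ≤ s)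
    {a : selfAdjoint C(Cantor, ℂ)} (ha : cantorLip r a ≤ 1) (N : ℕ) :
    cantorLip s (cantorExpSelfAdjoint N a) ≤ ENNReal.ofReal ((s / r) ^ N) := by
  have hs := hr.trans_le hrs
  rw [cantorLip_le_ofReal_iff hs (by positivity)]
  intro n
  rw [coe_cantorExpSelfAdjoint]
  have hpos := cantorBeta_pos hs n
  rcases le_total N n with h | h
  · rw [cantorExp_cantorExp_of_le h, sub_self, norm_zero]
    positivity
  -- Commutation gives `E_N a - E_n (E_N a) = E_N (a - E_n a)`, so contractivity yields the bound
  -- `cantorBeta r n = (s/r)^n * cantorBeta s n`; the factor is largest at `n = N`.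
  · rw [cantorExp_comm, ← map_sub]
    refine (norm_cantorExp_le _ _).trans (((cantorLip_le_one_iff hr a).1 ha n).trans ?_)
    have e : cantorBeta r n = (s / r) ^ n * cantorBeta s n := by
      rw [cantorBeta_eq, cantorBeta_eq, div_pow, inv_pow, inv_pow]
      field_simp
    rw [e]
    gcongr
    rwa [one_le_div hr]

/-- Only the terms with `n < N` of the supremum can be nonzero, and a finite sum dominates them. -/
theorem cantorLip_cantorExp_ne_top {r : ℝ} (hr : 0 < r) (a : selfAdjoint C(Cantor, ℂ)) (N : ℕ) :
    cantorLip r (cantorExpSelfAdjoint N a) ≠ ∞ := by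
  refine ne_top_of_le_ne_top (ENNReal.ofReal_ne_top (r := 2 * ‖(a : C(Cantor, ℂ))‖ / cantorBeta r N
    + ∑ n ∈ Finset.range N, 2 * ‖(a : C(Cantor, ℂ))‖ / cantorBeta r n)) ?_
  have hb := cantorBeta_pos hr
  have hnn : ∀ n, 0 ≤ 2 * ‖(a : C(Cantor, ℂ))‖ / cantorBeta r n := fun n => by
    have := hb n
    positivity
  have hsum : 0 ≤ ∑ n ∈ Finset.range N, 2 * ‖(a : C(Cantor, ℂ))‖ / cantorBeta r n :=
    Finset.sum_nonneg fun n _ => hnn n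
  rw [cantorLip_le_ofReal_iff hr (add_nonneg (hnn N) hsum)]
  intro n
  rw [coe_cantorExpSelfAdjoint]
  rcases le_or_gt N n with h | h
  · rw [cantorExp_cantorExp_of_le h, sub_self, norm_zero]
    exact mul_nonneg (add_nonneg (hnn N) hsum) (hb n).le
  · rw [← div_le_iff₀ (hb n)]
    refine le_trans ?_ (le_add_of_nonneg_left (hnn N))
    refine le_trans ?_ (Finset.single_le_sum (fun n _ => hnn n) (Finset.mem_range.2 h))
    have := hb n
    gcongr
    refine (norm_sub_le _ _).trans ?_
    have := norm_cantorExp_le N (a : C(Cantor, ℂ))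
    have := norm_cantorExp_le n (cantorExp N (a : C(Cantor, ℂ)))
    linarith

theorem tendsto_cantorExpSelfAdjoint (a : selfAdjoint C(Cantor, ℂ)) :
    Tendsto (fun n => cantorExpSelfAdjoint n a) atTop (𝓝 a) :=
  tendsto_subtype_rng.2 (tendsto_cantorExp _)

theorem dense_domain_cantorLip {r : ℝ} (hr : 0 < r) : Dense {a | cantorLip r a ≠ ∞} := fun a =>
  mem_closure_of_tendsto (tendsto_cantorExpSelfAdjoint a)
    (Eventually.of_forall fun N => cantorLip_cantorExp_ne_top hr a N)

/-! ### The quasi-Leibniz inequality and lower semicontinuity. -/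

theorem norm_mul_sub_cantorExp_le (n : ℕ) (a b : C(Cantor, ℂ)) :
    ‖a * b - cantorExp n (a * b)‖ ≤
      2 * (‖a‖ * ‖b - cantorExp n b‖ + ‖b‖ * ‖a - cantorExp n a‖) := by
  -- The bimodule property gives `E (E a * b) = E a * E b`. The factor `2` arises from bounding `id
  -- - E` by `2` on the first summand; the second needs only `1`.
  have e : a * b - cantorExp n (a * b) = ((a - cantorExp n a) * b
      - cantorExp n ((a - cantorExp n a) * b)) + cantorExp n a * (b - cantorExp n b) := by
    have : cantorExp n ((a - cantorExp n a) * b) =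
        cantorExp n (a * b) - cantorExp n a * cantorExp n b := by
      rw [sub_mul, map_sub, cantorExp_mul_of_dependsOn (dependsOn_cantorExp n a)]
    rw [this]
    ring
  rw [e]
  have h1 := norm_cantorExp_le n ((a - cantorExp n a) * b)
  have h2 := norm_mul_le (a - cantorExp n a) b
  have h3 : ‖cantorExp n a * (b - cantorExp n b)‖ ≤ ‖a‖ * ‖b - cantorExp n b‖ :=
    (norm_mul_le _ _).trans (mul_le_mul_of_nonneg_right (norm_cantorExp_le n a) (norm_nonneg _))
  have h4 := norm_sub_le ((a - cantorExp n a) * b) (cantorExp n ((a - cantorExp n a) * b))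
  refine (norm_add_le _ _).trans ?_
  nlinarith [mul_nonneg (norm_nonneg a) (norm_nonneg (b - cantorExp n b))]

theorem coe_jordan (a b : selfAdjoint C(Cantor, ℂ)) :
    (jordan a b : C(Cantor, ℂ)) = (a : C(Cantor, ℂ)) * b := by
  change (1 / 2 : ℂ) • ((a : C(Cantor, ℂ)) * b + b * a) = _
  rw [mul_comm (b : C(Cantor, ℂ)), ← two_smul ℂ, smul_smul]
  norm_num

theorem lie_eq_zero (a b : selfAdjoint C(Cantor, ℂ)) : lie a b = 0 := by
  ext1
  change (1 / (2 * Complex.I) : ℂ) • ((a : C(Cantor, ℂ)) * b - b * a) = 0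
  rw [mul_comm (b : C(Cantor, ℂ)), sub_self, smul_zero]

theorem cantorLip_quasiLeibniz {r : ℝ} (hr : 0 < r) (a b : selfAdjoint C(Cantor, ℂ)) :
    max (cantorLip r (jordan a b)) (cantorLip r (lie a b)) ≤
      2 * (‖a‖ₑ * cantorLip r b + ‖b‖ₑ * cantorLip r a) := by
  have hlie : cantorLip r (lie a b) = 0 :=
    (cantorLip_eq_zero_iff hr _).2 ⟨0, by rw [lie_eq_zero, zero_smul]⟩
  rw [hlie]
  refine max_le ?_ bot_le
  rw [cantorLip_eq r (jordan a b), coe_jordan]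
  refine iSup_le fun n => ?_
  have hle : ∀ c : selfAdjoint C(Cantor, ℂ), ‖(c : C(Cantor, ℂ)) - cantorExp n (c : C(Cantor, ℂ))‖ₑ /
      ENNReal.ofReal (cantorBeta r n) ≤ cantorLip r c := fun c => by
    rw [cantorLip_eq]
    exact le_iSup (fun n => ‖(c : C(Cantor, ℂ)) - cantorExp n (c : C(Cantor, ℂ))‖ₑ /
      ENNReal.ofReal (cantorBeta r n)) n
  calc ‖(a : C(Cantor, ℂ)) * b - cantorExp n ((a : C(Cantor, ℂ)) * b)‖ₑ /
        ENNReal.ofReal (cantorBeta r n)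
      ≤ (2 * (‖a‖ₑ * ‖(b : C(Cantor, ℂ)) - cantorExp n (b : C(Cantor, ℂ))‖ₑ
          + ‖b‖ₑ * ‖(a : C(Cantor, ℂ)) - cantorExp n (a : C(Cantor, ℂ))‖ₑ)) /
          ENNReal.ofReal (cantorBeta r n) := by
        refine ENNReal.div_le_div_right ?_ _
        have h := ENNReal.ofReal_le_ofReal
          (norm_mul_sub_cantorExp_le n (a : C(Cantor, ℂ)) (b : C(Cantor, ℂ)))
        rw [ENNReal.ofReal_mul zero_le_two, ENNReal.ofReal_add (by positivity) (by positivity),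
          ENNReal.ofReal_mul (norm_nonneg _), ENNReal.ofReal_mul (norm_nonneg _)] at h
        simp only [ofReal_norm, ENNReal.ofReal_ofNat] at h
        exact h
    _ = 2 * (‖a‖ₑ * (‖(b : C(Cantor, ℂ)) - cantorExp n (b : C(Cantor, ℂ))‖ₑ /
            ENNReal.ofReal (cantorBeta r n))
          + ‖b‖ₑ * (‖(a : C(Cantor, ℂ)) - cantorExp n (a : C(Cantor, ℂ))‖ₑ /
            ENNReal.ofReal (cantorBeta r n))) := by
        rw [mul_div_assoc, ENNReal.add_div, mul_div_assoc, mul_div_assoc]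
    _ ≤ _ := by
        gcongr
        · exact hle b
        · exact hle a

theorem lowerSemicontinuous_cantorLip {r : ℝ} (hr : 0 < r) : LowerSemicontinuous (cantorLip r) := by
  have e : cantorLip r = fun a : selfAdjoint C(Cantor, ℂ) => ⨆ n, ‖(a : C(Cantor, ℂ)) - cantorExp n (a : C(Cantor, ℂ))‖ₑ /
      ENNReal.ofReal (cantorBeta r n) := funext (cantorLip_eq r)
  rw [e]
  refine lowerSemicontinuous_iSup fun n => Continuous.lowerSemicontinuous ?_
  refine ENNReal.continuous_div_const _ (by simpa using cantorBeta_pos hr n) |>.comp ?_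
  exact (continuous_subtype_val.sub ((cantorExp n).continuous.comp continuous_subtype_val)).enorm

/-! ### The Monge-Kantorovich metric of the Cantor set -/

theorem mkDist_self {A : Type} [CStarAlgebra A] (L : selfAdjoint A → ℝ≥0∞) (φ : StateSpace A) :
    mkDist L φ φ = 0 := by
  simp [mkDist]

theorem mkDist_comm {A : Type} [CStarAlgebra A] (L : selfAdjoint A → ℝ≥0∞) (φ ψ : StateSpace A) :
    mkDist L φ ψ = mkDist L ψ φ := by
  simp only [mkDist]
  exact iSup_congr fun a => iSup_congr fun _ => by rw [← enorm_neg, neg_sub]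

theorem mkDist_triangle {A : Type} [CStarAlgebra A] (L : selfAdjoint A → ℝ≥0∞)
    (φ ψ χ : StateSpace A) : mkDist L φ χ ≤ mkDist L φ ψ + mkDist L ψ χ := by
  refine iSup₂_le fun a ha => ?_
  rw [← sub_add_sub_cancel (φ.1 (a : A)) (ψ.1 (a : A)) (χ.1 (a : A))]
  exact (enorm_add_le _ _).trans (add_le_add
    (le_iSup₂ (f := fun (a : selfAdjoint A) (_ : L a ≤ 1) => ‖φ.1 (a : A) - ψ.1 (a : A)‖ₑ) a ha)
    (le_iSup₂ (f := fun (a : selfAdjoint A) (_ : L a ≤ 1) => ‖ψ.1 (a : A) - χ.1 (a : A)‖ₑ) a ha))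

theorem state_smul_one (φ : StateSpace C(Cantor, ℂ)) (t : ℝ) :
    φ.1 ((t • (1 : selfAdjoint C(Cantor, ℂ)) : selfAdjoint C(Cantor, ℂ)) : C(Cantor, ℂ)) = t := by
  have e : ((t • (1 : selfAdjoint C(Cantor, ℂ)) : selfAdjoint C(Cantor, ℂ)) : C(Cantor, ℂ)) =
    (t : ℂ) • (1 : C(Cantor, ℂ)) := rfl
  rw [e, map_smul, φ.2.1, smul_eq_mul, mul_one]

/-- The pointwise square root exhibits `f` in the form `star g * g`. -/
theorem state_nonneg (φ : StateSpace C(Cantor, ℂ)) {f : C(Cantor, ℂ)} (hf : ∀ z, 0 ≤ f z) :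
    0 ≤ φ.1 f := by
  have e : f = star (⟨fun z => (Real.sqrt (f z).re : ℂ), by fun_prop⟩ : C(Cantor, ℂ)) *
      ⟨fun z => (Real.sqrt (f z).re : ℂ), by fun_prop⟩ := by
    ext z
    obtain ⟨h1, h2⟩ := Complex.nonneg_iff.1 (hf z)
    rw [ContinuousMap.mul_apply, ContinuousMap.star_apply]
    simp only [ContinuousMap.coe_mk, RCLike.star_def, Complex.conj_ofReal]
    rw [← Complex.ofReal_mul, Real.mul_self_sqrt h1]
    exact Complex.ext rfl h2.symm
  rw [e]
  exact φ.2.2 _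

/-- Both `‖a‖ + a` and `‖a‖ - a` are pointwise nonnegative, so positivity squeezes the value and
makes it real. -/
theorem norm_state_le (φ : StateSpace C(Cantor, ℂ)) (a : selfAdjoint C(Cantor, ℂ)) :
    ‖φ.1 (a : C(Cantor, ℂ))‖ ≤ ‖(a : C(Cantor, ℂ))‖ := by
  have him : ∀ z, ((a : C(Cantor, ℂ)) z).im = 0 := fun z =>
    Complex.conj_eq_iff_im.1 (congrArg (fun f : C(Cantor, ℂ) => f z) a.2.star_eq)
  have hre : ∀ z, |((a : C(Cantor, ℂ)) z).re| ≤ ‖(a : C(Cantor, ℂ))‖ := fun z =>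
    (Complex.abs_re_le_norm _).trans (ContinuousMap.norm_coe_le_norm _ z)
  have h1 : 0 ≤ φ.1 (((‖(a : C(Cantor, ℂ))‖ : ℝ) : ℂ) • (1 : C(Cantor, ℂ)) + a) := by
    refine state_nonneg φ fun z => Complex.nonneg_iff.2 ?_
    have := (abs_le.1 (hre z)).1
    simp [him z]
    linarith
  have h2 : 0 ≤ φ.1 (((‖(a : C(Cantor, ℂ))‖ : ℝ) : ℂ) • (1 : C(Cantor, ℂ)) - a) := by
    refine state_nonneg φ fun z => Complex.nonneg_iff.2 ?_
    have := (abs_le.1 (hre z)).2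
    simp [him z]
    linarith
  rw [map_add, map_smul, φ.2.1, smul_eq_mul, mul_one, Complex.nonneg_iff] at h1
  rw [map_sub, map_smul, φ.2.1, smul_eq_mul, mul_one, Complex.nonneg_iff] at h2
  simp only [Complex.add_re, Complex.add_im, Complex.sub_re, Complex.ofReal_re,
    Complex.ofReal_im, zero_add] at h1 h2
  have e : φ.1 (a : C(Cantor, ℂ)) = ((φ.1 (a : C(Cantor, ℂ))).re : ℂ) :=
    Complex.ext rfl h1.2.symm
  rw [e, Complex.norm_real, Real.norm_eq_abs, abs_le]
  exact ⟨by linarith [h1.1], by linarith [h2.1]⟩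

/-- Two states differ on a self-adjoint element as they do on its deviation from its mean. -/
theorem state_sub_state_eq (φ ψ : StateSpace C(Cantor, ℂ)) (a : selfAdjoint C(Cantor, ℂ)) :
    φ.1 (a : C(Cantor, ℂ)) - ψ.1 (a : C(Cantor, ℂ)) =
      φ.1 ((a : C(Cantor, ℂ)) - cantorExp 0 (a : C(Cantor, ℂ))) -
        ψ.1 ((a : C(Cantor, ℂ)) - cantorExp 0 (a : C(Cantor, ℂ))) := by
  obtain ⟨t, ht⟩ := cantorExp_zero_eq_smul_one a
  rw [map_sub, map_sub, ← coe_cantorExpSelfAdjoint, ht, state_smul_one, state_smul_one]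
  ring

theorem norm_state_sub_state_le (φ ψ : StateSpace C(Cantor, ℂ)) (n : ℕ)
    (a : selfAdjoint C(Cantor, ℂ)) :
    ‖φ.1 ((a : C(Cantor, ℂ)) - cantorExp n (a : C(Cantor, ℂ))) -
        ψ.1 ((a : C(Cantor, ℂ)) - cantorExp n (a : C(Cantor, ℂ)))‖ ≤
      2 * ‖(a : C(Cantor, ℂ)) - cantorExp n (a : C(Cantor, ℂ))‖ := by
  have h1 := norm_state_le φ (a - cantorExpSelfAdjoint n a)
  have h2 := norm_state_le ψ (a - cantorExpSelfAdjoint n a)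
  rw [AddSubgroup.coe_sub, coe_cantorExpSelfAdjoint] at h1 h2
  refine (norm_sub_le _ _).trans ?_
  linarith

/-- The deviation from the mean has norm at most `cantorBeta r 0 = 1/2`, and two states are
compared. The finiteness obtained here allows passing to a real-valued distance. -/
theorem mkDist_cantorLip_le_one {r : ℝ} (hr : 0 < r) (φ ψ : StateSpace C(Cantor, ℂ)) :
    mkDist (cantorLip r) φ ψ ≤ 1 := by
  refine iSup₂_le fun a ha => ?_
  have h := (cantorLip_le_one_iff hr a).1 ha 0
  rw [cantorBeta_zero] at h
  have h2 := norm_state_sub_state_le φ ψ 0 a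
  rw [← state_sub_state_eq] at h2
  rw [← ofReal_norm, ← ENNReal.ofReal_one]
  exact ENNReal.ofReal_le_ofReal (by linarith)

/-- The indicator function of a cylinder. -/
noncomputable def cantorCylinder (n : ℕ) (σ : Fin n → ZMod 2) : C(Cantor, ℂ) :=
  ⟨fun z => if (fun i : Fin n => z i) = σ then 1 else 0,
    (continuous_of_discreteTopology (f := fun τ : Fin n → ZMod 2 => if τ = σ then (1 : ℂ) else 0)).comp
      (continuous_pi fun i : Fin n => continuous_apply (i : ℕ))⟩

/-- The element of a cylinder whose further coordinates vanish. -/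
def cantorExtend {n : ℕ} (σ : Fin n → ZMod 2) : Cantor :=
  fun j => if h : j < n then σ ⟨j, h⟩ else 0

theorem eq_sum_cantorCylinder {n : ℕ} {b : C(Cantor, ℂ)} (hb : DependsOn b (Set.Iio n)) :
    b = ∑ σ : Fin n → ZMod 2, b (cantorExtend σ) • cantorCylinder n σ := by
  ext z
  rw [ContinuousMap.sum_apply, Finset.sum_eq_single fun i : Fin n => z i]
  · have : b (cantorExtend fun i : Fin n => z i) = b z :=
      hb fun j hj => by simp [cantorExtend, Set.mem_Iio.1 hj]
    simp [cantorCylinder, this]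
  · intro σ _ hσ
    simp [cantorCylinder, hσ.symm]
  · simp

/-- This replaces total boundedness of the unit ball modulo scalars: split `a` minus its mean into
`a - E_n a`, of norm at most `cantorBeta r n`, and a combination of cylinders with coefficients
bounded by `1`. -/
theorem mkDist_cantorLip_le {r : ℝ} (hr : 0 < r) (φ ψ : StateSpace C(Cantor, ℂ)) (n : ℕ) :
    mkDist (cantorLip r) φ ψ ≤ ENNReal.ofReal (2 * cantorBeta r n +
      ∑ σ : Fin n → ZMod 2, ‖φ.1 (cantorCylinder n σ) - ψ.1 (cantorCylinder n σ)‖) := by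
  refine iSup₂_le fun a ha => ?_
  rw [← ofReal_norm]
  refine ENNReal.ofReal_le_ofReal ?_
  have h := (cantorLip_le_one_iff hr a).1 ha
  have h0 := h 0
  rw [cantorBeta_zero] at h0
  set b := cantorExp n ((a : C(Cantor, ℂ)) - cantorExp 0 (a : C(Cantor, ℂ))) with hb
  have hsplit : (a : C(Cantor, ℂ)) - cantorExp 0 (a : C(Cantor, ℂ)) =
      ((a : C(Cantor, ℂ)) - cantorExp n (a : C(Cantor, ℂ))) + b := by
    rw [hb, map_sub, cantorExp_cantorExp_of_le n.zero_le]
    abel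
  have hbn : ∀ z, ‖b z‖ ≤ 1 := fun z =>
    (b.norm_coe_le_norm z).trans ((norm_cantorExp_le _ _).trans (h0.trans (by norm_num)))
  have hbd : DependsOn b (Set.Iio n) := dependsOn_cantorExp n _
  have hbs : φ.1 b - ψ.1 b = ∑ σ : Fin n → ZMod 2, b (cantorExtend σ) *
      (φ.1 (cantorCylinder n σ) - ψ.1 (cantorCylinder n σ)) := by
    conv_lhs => rw [eq_sum_cantorCylinder hbd]
    rw [map_sum, map_sum, ← Finset.sum_sub_distrib]
    exact Finset.sum_congr rfl fun σ _ => by rw [map_smul, map_smul, smul_eq_mul, smul_eq_mul, mul_sub]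
  rw [state_sub_state_eq, hsplit, map_add, map_add, add_sub_add_comm]
  refine (norm_add_le _ _).trans (add_le_add ?_ ?_)
  · exact (norm_state_sub_state_le φ ψ n a).trans (by linarith [h n])
  · rw [hbs]
    refine (norm_sum_le _ _).trans (Finset.sum_le_sum fun σ _ => ?_)
    rw [norm_mul]
    exact mul_le_of_le_one_left (norm_nonneg _) (hbn _)

theorem eventually_mkDist_lt {r : ℝ} (hr : 1 < r) (φ : StateSpace C(Cantor, ℂ)) {ε : ℝ}
    (hε : 0 < ε) : ∀ᶠ ψ in 𝓝 φ, mkDist (cantorLip r) ψ φ < ENNReal.ofReal ε := by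
  obtain ⟨n, hn⟩ := ((tendsto_cantorBeta hr).eventually (gt_mem_nhds (half_pos hε))).exists
  have hc : Continuous fun ψ : StateSpace C(Cantor, ℂ) => 2 * cantorBeta r n +
      ∑ σ : Fin n → ZMod 2, ‖ψ.1 (cantorCylinder n σ) - φ.1 (cantorCylinder n σ)‖ :=
    continuous_const.add (continuous_finsetSum _ fun σ _ =>
      (((WeakDual.eval_continuous _).comp continuous_subtype_val).sub continuous_const).norm)
  have hlt : 2 * cantorBeta r n +
      ∑ σ : Fin n → ZMod 2, ‖φ.1 (cantorCylinder n σ) - φ.1 (cantorCylinder n σ)‖ < ε := by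
    simp only [sub_self, norm_zero, Finset.sum_const_zero, add_zero]
    linarith
  filter_upwards [hc.continuousAt.eventually (gt_mem_nhds hlt)] with ψ hψ
  exact (mkDist_cantorLip_le (zero_lt_one.trans hr) ψ φ n).trans_lt
    ((ENNReal.ofReal_lt_ofReal_iff hε).2 hψ)

/-- A seminorm bounds the differences of two states on its domain by their distance. -/
theorem enorm_state_sub_state_le_mkDist (r : ℝ) (φ ψ : StateSpace C(Cantor, ℂ))
    {a : selfAdjoint C(Cantor, ℂ)} {t : ℝ} (ht : 0 < t) (ha : cantorLip r a ≤ ENNReal.ofReal t) :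
    ‖φ.1 (a : C(Cantor, ℂ)) - ψ.1 (a : C(Cantor, ℂ))‖ₑ ≤
      ENNReal.ofReal t * mkDist (cantorLip r) φ ψ := by
  have h1 : cantorLip r (t⁻¹ • a) ≤ 1 := by
    rw [cantorLip_smul, ← ofReal_norm, Real.norm_of_nonneg (inv_pos.2 ht).le]
    refine (mul_le_mul_right ha _).trans ?_
    rw [← ENNReal.ofReal_mul (inv_pos.2 ht).le, inv_mul_cancel₀ ht.ne', ENNReal.ofReal_one]
  have e : (a : C(Cantor, ℂ)) = (t : ℂ) • ((t⁻¹ • a : selfAdjoint C(Cantor, ℂ)) : C(Cantor, ℂ)) := by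
    change _ = (t : ℂ) • (((t⁻¹ : ℝ) : ℂ) • (a : C(Cantor, ℂ)))
    rw [smul_smul, ← Complex.ofReal_mul, mul_inv_cancel₀ ht.ne', Complex.ofReal_one, one_smul]
  rw [e, map_smul, map_smul, ← smul_sub, enorm_smul]
  gcongr
  · rw [← ofReal_norm, Complex.norm_real, Real.norm_of_nonneg ht.le]
  · exact le_iSup₂ (f := fun (a : selfAdjoint C(Cantor, ℂ)) (_ : cantorLip r a ≤ 1) =>
      ‖φ.1 (a : C(Cantor, ℂ)) - ψ.1 (a : C(Cantor, ℂ))‖ₑ) _ h1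

/-- Approximate `a` by `E_N a`, which has finite seminorm. The remainder costs at most twice `ε /
4`, and `δ` is chosen so that `E_N a` costs at most `ε / 2`, uniformly in the states. -/
theorem exists_mkDist_lt_imp_selfAdjoint {r : ℝ} (hr : 0 < r) (a : selfAdjoint C(Cantor, ℂ)) {ε : ℝ}
    (hε : 0 < ε) : ∃ δ > 0, ∀ φ ψ : StateSpace C(Cantor, ℂ),
      mkDist (cantorLip r) φ ψ < ENNReal.ofReal δ →
        ‖φ.1 (a : C(Cantor, ℂ)) - ψ.1 (a : C(Cantor, ℂ))‖ < ε := by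
  obtain ⟨N, hN⟩ := ((Metric.tendsto_nhds.1 (tendsto_cantorExp (a : C(Cantor, ℂ))))
    (ε / 4) (by positivity)).exists
  rw [dist_comm, dist_eq_norm] at hN
  -- Adding `1` keeps `t` positive even if the seminorm vanishes.
  set t := (cantorLip r (cantorExpSelfAdjoint N a)).toReal + 1 with ht
  have htpos : 0 < t := by positivity
  have hLt : cantorLip r (cantorExpSelfAdjoint N a) ≤ ENNReal.ofReal t :=
    (ENNReal.le_ofReal_iff_toReal_le (cantorLip_cantorExp_ne_top hr a N) htpos.le).2 (by linarith)
  refine ⟨ε / (2 * t), by positivity, fun φ ψ h => ?_⟩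
  have h1 := enorm_state_sub_state_le_mkDist r φ ψ htpos hLt
  have h2 : ‖φ.1 (cantorExp N (a : C(Cantor, ℂ))) - ψ.1 (cantorExp N (a : C(Cantor, ℂ)))‖ ≤ ε / 2 := by
    have h3 := h1.trans (mul_le_mul_right h.le _)
    rw [← ENNReal.ofReal_mul htpos.le, ← ofReal_norm,
      ENNReal.ofReal_le_ofReal_iff (by positivity)] at h3
    refine h3.trans_eq ?_
    field_simp
  have h4 := norm_state_sub_state_le φ ψ N a
  have e : φ.1 (a : C(Cantor, ℂ)) - ψ.1 (a : C(Cantor, ℂ)) =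
      (φ.1 ((a : C(Cantor, ℂ)) - cantorExp N (a : C(Cantor, ℂ))) -
        ψ.1 ((a : C(Cantor, ℂ)) - cantorExp N (a : C(Cantor, ℂ)))) +
      (φ.1 (cantorExp N (a : C(Cantor, ℂ))) - ψ.1 (cantorExp N (a : C(Cantor, ℂ)))) := by
    rw [map_sub, map_sub]
    ring
  rw [e]
  refine (norm_add_le _ _).trans_lt ?_
  linarith

theorem exists_mkDist_lt_imp {r : ℝ} (hr : 0 < r) (a : C(Cantor, ℂ)) {ε : ℝ}
    (hε : 0 < ε) : ∃ δ > 0, ∀ φ ψ : StateSpace C(Cantor, ℂ),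
      mkDist (cantorLip r) φ ψ < ENNReal.ofReal δ → ‖φ.1 a - ψ.1 a‖ < ε := by
  obtain ⟨δ₁, hδ₁, h₁⟩ := exists_mkDist_lt_imp_selfAdjoint hr (realPart a) (half_pos hε)
  obtain ⟨δ₂, hδ₂, h₂⟩ := exists_mkDist_lt_imp_selfAdjoint hr (imaginaryPart a) (half_pos hε)
  refine ⟨min δ₁ δ₂, lt_min hδ₁ hδ₂, fun φ ψ h => ?_⟩
  have h1 := h₁ φ ψ (h.trans_le (ENNReal.ofReal_le_ofReal (min_le_left _ _)))
  have h2 := h₂ φ ψ (h.trans_le (ENNReal.ofReal_le_ofReal (min_le_right _ _)))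
  rw [← realPart_add_I_smul_imaginaryPart a, map_add, map_add, map_smul, map_smul,
    add_sub_add_comm, ← smul_sub]
  refine (norm_add_le _ _).trans_lt ?_
  rw [norm_smul, Complex.norm_I, one_mul]
  linarith

theorem exists_metricSpace_mkDist {r : ℝ} (hr : 1 < r) :
    ∃ m : MetricSpace (StateSpace C(Cantor, ℂ)),
      (∀ φ ψ, ENNReal.ofReal (m.dist φ ψ) = mkDist (cantorLip r) φ ψ) ∧
        m.toUniformSpace.toTopologicalSpace = instTopologicalSpaceSubtype := by
  have hr0 := zero_lt_one.trans hr
  have hfin : ∀ φ ψ, mkDist (cantorLip r) φ ψ ≠ ∞ := fun φ ψ =>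
    ne_top_of_le_ne_top ENNReal.one_ne_top (mkDist_cantorLip_le_one hr0 φ ψ)
  let m : MetricSpace (StateSpace C(Cantor, ℂ)) :=
    { dist := fun φ ψ => (mkDist (cantorLip r) φ ψ).toReal
      dist_self := fun φ => by simp only [mkDist_self, ENNReal.toReal_zero]
      dist_comm := fun φ ψ => by simp only [mkDist_comm]
      dist_triangle := fun φ ψ χ => by
        rw [← ENNReal.toReal_add (hfin _ _) (hfin _ _)]
        exact ENNReal.toReal_mono (ENNReal.add_ne_top.2 ⟨hfin _ _, hfin _ _⟩) (mkDist_triangle _ _ _ _)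
      eq_of_dist_eq_zero := fun {φ ψ} h => by
        have h0 : mkDist (cantorLip r) φ ψ = 0 :=
          ((ENNReal.toReal_eq_zero_iff _).1 h).resolve_right (hfin _ _)
        refine Subtype.ext (DFunLike.ext _ _ fun a => sub_eq_zero.1 (norm_le_zero_iff.1 ?_))
        refine le_of_forall_pos_le_add fun ε hε => ?_
        obtain ⟨δ, hδ, H⟩ := exists_mkDist_lt_imp hr0 a hε
        rw [zero_add]
        exact (H φ ψ (by rw [h0]; exact ENNReal.ofReal_pos.2 hδ)).le }
  have hdist : ∀ φ ψ, ENNReal.ofReal (m.dist φ ψ) = mkDist (cantorLip r) φ ψ := fun φ ψ =>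
    ENNReal.ofReal_toReal (hfin φ ψ)
  refine ⟨m, hdist, le_antisymm ?_ ?_⟩
  -- The metric topology is finer than weak*: every evaluation is continuous for the metric.
  · have hcont : ∀ a : C(Cantor, ℂ), @Continuous _ _ m.toUniformSpace.toTopologicalSpace _
        fun φ : StateSpace C(Cantor, ℂ) => φ.1 a := ?_
    · exact continuous_iff_le_induced.1
        (@WeakDual.continuous_of_continuous_eval _ _ _ _ _ _ _ _ _ _
          m.toUniformSpace.toTopologicalSpace _ hcont)
    intro a
    refine (@Metric.continuous_iff _ _ m.toPseudoMetricSpace _ _).2 fun φ ε hε => ?_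
    obtain ⟨δ, hδ, H⟩ := exists_mkDist_lt_imp hr0 a hε
    refine ⟨δ, hδ, fun ψ h => ?_⟩
    rw [dist_eq_norm]
    refine H ψ φ ?_
    rw [← hdist]
    exact (ENNReal.ofReal_lt_ofReal_iff hδ).2 h
  -- Conversely, metric balls are weak* neighbourhoods of their centres, by the cylinder estimate.
  · refine continuous_id_iff_le.1 ?_
    refine (@Metric.continuous_iff' _ _ m.toPseudoMetricSpace _ _).2 fun φ ε hε => ?_
    filter_upwards [eventually_mkDist_lt hr φ hε] with ψ h
    rw [← hdist] at h
    exact (ENNReal.ofReal_lt_ofReal_iff hε).1 h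

theorem isQQCMS_cantorLip {r : ℝ} (hr : 1 < r) : IsQQCMS 2 0 C(Cantor, ℂ) (cantorLip r) where
  nontrivial := inferInstance
  add_le := cantorLip_add_le r
  smul := cantorLip_smul r
  dense_domain := dense_domain_cantorLip (zero_lt_one.trans hr)
  eq_zero_iff := cantorLip_eq_zero_iff (zero_lt_one.trans hr)
  quasiLeibniz a b _ _ := by
    simpa using cantorLip_quasiLeibniz (zero_lt_one.trans hr) a b
  metrizes := exists_metricSpace_mkDist hr
  lowerSemicontinuous := lowerSemicontinuous_cantorLip (zero_lt_one.trans hr)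

/-! ### Continuity in the quantum propinquity -/

theorem cantorLip_mono {r s : ℝ} (hr : 0 < r) (hrs : r ≤ s) (a : selfAdjoint C(Cantor, ℂ)) :
    cantorLip r a ≤ cantorLip s a := by
  rw [cantorLip_eq, cantorLip_eq]
  refine iSup_mono fun n => ENNReal.div_le_div_left (ENNReal.ofReal_le_ofReal ?_) _
  rw [cantorBeta_eq, cantorBeta_eq]
  have := hr.trans_le hrs
  gcongr

/-- The length of the identity bridge is the Hausdorff distance of the unit balls. -/
theorem length_refl_le {A : Type} [CStarAlgebra A] (h : Nonempty (StateSpace A))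
    (L L' : selfAdjoint A → ℝ≥0∞) {ε : ℝ≥0∞}
    (h₁ : ∀ a, L a ≤ 1 → ∃ b, L' b ≤ 1 ∧ ‖(a : A) - b‖ₑ ≤ ε)
    (h₂ : ∀ b, L' b ≤ 1 → ∃ a, L a ≤ 1 ∧ ‖(a : A) - b‖ₑ ≤ ε) :
    (Bridge.refl A h).length L L' ≤ ε := by
  -- With pivot `1` every state belongs to the level set, so the height vanishes and only the reach
  -- remains.
  have hu : pullback (StarAlgHom.id ℂ A) '' levelSet (1 : A) = Set.univ :=
    Set.eq_univ_of_forall fun φ => ⟨φ, by simp [levelSet], rfl⟩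
  have hz : ∀ M : selfAdjoint A → ℝ≥0∞,
      hausdorff (mkDist M) Set.univ (pullback (StarAlgHom.id ℂ A) '' levelSet (1 : A)) ≤ ε := by
    intro M
    rw [hu]
    refine max_le ?_ ?_ <;>
      exact iSup₂_le fun φ hφ => (iInf₂_le φ hφ).trans ((mkDist_self M φ).le.trans bot_le)
  have he : ∀ a b : selfAdjoint A,
      ‖(Bridge.refl A h).left (a : A) * (Bridge.refl A h).pivot -
        (Bridge.refl A h).pivot * (Bridge.refl A h).right (b : A)‖ₑ = ‖(a : A) - b‖ₑ := by
    intro a b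
    change ‖(a : A) * 1 - 1 * (b : A)‖ₑ = _
    rw [mul_one, one_mul]
  refine max_le (max_le (hz L) (hz L')) (max_le ?_ ?_)
  · refine iSup₂_le fun a ha => ?_
    obtain ⟨b, hb, hab⟩ := h₁ a ha
    exact (iInf₂_le b hb).trans ((he a b).trans_le hab)
  · refine iSup₂_le fun b hb => ?_
    obtain ⟨a, ha, hab⟩ := h₂ b hb
    exact (iInf₂_le a ha).trans ((he a b).trans_le hab)

/-- Elements of the `L_r` unit ball are close to the `L_s` unit ball for `s ≥ r`. -/
theorem exists_cantorLip_le_one_norm_sub_le {r s : ℝ} (hr : 0 < r) (hrs : r ≤ s) (N : ℕ)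
    {a : selfAdjoint C(Cantor, ℂ)} (ha : cantorLip r a ≤ 1) :
    ∃ b, cantorLip s b ≤ 1 ∧
      ‖(a : C(Cantor, ℂ)) - (b : C(Cantor, ℂ))‖ ≤ cantorBeta r N + (1 - (r / s) ^ N) := by
  have hs := hr.trans_le hrs
  set c : ℝ := (r / s) ^ N with hc
  have hc0 : 0 ≤ c := by positivity
  have hc1 : c ≤ 1 := pow_le_one₀ (by positivity) ((div_le_one hs).2 hrs)
  -- The factor `c` cancels the growth `(s/r)^N`. Contracting towards the mean rather than towards
  -- `0` matters: the scalar has seminorm zero, and the displacement is `1 - c` times a deviation of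
  -- bounded norm, whereas `a` itself is unbounded over the unit ball.
  refine ⟨c • cantorExpSelfAdjoint N a + (1 - c) • cantorExpSelfAdjoint 0 a, ?_, ?_⟩
  · obtain ⟨t, ht⟩ := cantorExp_zero_eq_smul_one a
    refine (cantorLip_add_le s _ _).trans ?_
    rw [ht, smul_smul, cantorLip_smul_one hs, add_zero, cantorLip_smul, ← ofReal_norm,
      Real.norm_of_nonneg hc0]
    refine (mul_le_mul_right (cantorLip_cantorExp_le hr hrs ha N) _).trans ?_
    rw [← ENNReal.ofReal_mul hc0, hc, ← mul_pow, div_mul_div_comm, mul_comm r s, div_self (by positivity),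
      one_pow, ENNReal.ofReal_one]
  · have h := (cantorLip_le_one_iff hr a).1 ha
    have h0 := h 0
    rw [cantorBeta_zero] at h0
    have e : (a : C(Cantor, ℂ)) - ((c • cantorExpSelfAdjoint N a + (1 - c) • cantorExpSelfAdjoint 0 a :
        selfAdjoint C(Cantor, ℂ)) : C(Cantor, ℂ)) =
        (a - cantorExp N (a : C(Cantor, ℂ))) +
          ((1 - c : ℝ) : ℂ) • cantorExp N ((a : C(Cantor, ℂ)) - cantorExp 0 (a : C(Cantor, ℂ))) := by
      change (a : C(Cantor, ℂ)) - ((c : ℂ) • cantorExp N (a : C(Cantor, ℂ)) +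
        ((1 - c : ℝ) : ℂ) • cantorExp 0 (a : C(Cantor, ℂ))) = _
      rw [map_sub, cantorExp_cantorExp_of_le N.zero_le, Complex.ofReal_sub, Complex.ofReal_one]
      module
    rw [e]
    refine (norm_add_le _ _).trans (add_le_add (h N) ?_)
    rw [norm_smul, Complex.norm_real, Real.norm_of_nonneg (sub_nonneg.2 hc1)]
    exact mul_le_of_le_one_right (sub_nonneg.2 hc1)
      ((norm_cantorExp_le _ _).trans (h0.trans (by norm_num)))

theorem edist_cantor_le {r s : ℝ} (hr : 1 < r) (hrs : r ≤ s) (N : ℕ) :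
    edist (⟨C(Cantor, ℂ), cantorLip r, isQQCMS_cantorLip hr⟩ : QQCMS 2 0)
        ⟨C(Cantor, ℂ), cantorLip s, isQQCMS_cantorLip (hr.trans_le hrs)⟩ ≤
      ENNReal.ofReal (cantorBeta r N + (1 - (r / s) ^ N)) := by
  have hr0 := zero_lt_one.trans hr
  refine (propinquity_le_length
    (X := (⟨C(Cantor, ℂ), cantorLip r, isQQCMS_cantorLip hr⟩ : QQCMS 2 0))
    (Y := ⟨C(Cantor, ℂ), cantorLip s, isQQCMS_cantorLip (hr.trans_le hrs)⟩)
    (Bridge.refl C(Cantor, ℂ) ⟨cantorTrace⟩)).trans ?_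
  -- The `s`-ball is contained in the `r`-ball, so in that direction `b` approximates itself.
  refine length_refl_le _ _ _ (fun a ha => ?_) fun b hb => ⟨b, ?_, by simp⟩
  · obtain ⟨b, hb, hab⟩ := exists_cantorLip_le_one_norm_sub_le hr0 hrs N ha
    refine ⟨b, hb, ?_⟩
    rw [← ofReal_norm]
    exact ENNReal.ofReal_le_ofReal hab
  · exact (cantorLip_mono hr0 hrs b).trans hb

/-- A form symmetric in `r` and `s`, continuous in `r`, that treats approach from both sides at
once. -/
theorem edist_cantor_le_min_max {r s : ℝ} (hr : 1 < r) (hs : 1 < s) (N : ℕ) :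
    edist (⟨C(Cantor, ℂ), cantorLip r, isQQCMS_cantorLip hr⟩ : QQCMS 2 0)
        ⟨C(Cantor, ℂ), cantorLip s, isQQCMS_cantorLip hs⟩ ≤
      ENNReal.ofReal ((min r s)⁻¹ ^ N / 2 + (1 - (min r s / max r s) ^ N)) := by
  rcases le_total r s with h | h
  · rw [min_eq_left h, max_eq_right h, ← cantorBeta_eq]
    exact edist_cantor_le hr h N
  · rw [min_eq_right h, max_eq_left h, ← cantorBeta_eq, edist_comm]
    exact edist_cantor_le hs h N

theorem continuous_cantor_propinquity :
    Continuous (fun r : Set.Ioi (1 : ℝ) =>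
      (⟨C(Cantor, ℂ), cantorLip r, isQQCMS_cantorLip r.2⟩ : QQCMS 2 0)) := by
  rw [continuous_iff_continuousAt]
  intro s
  rw [ContinuousAt, EMetric.tendsto_nhds]
  intro ε hε
  have hs0 : (0 : ℝ) < s := zero_lt_one.trans s.2
  have hev : ∀ᶠ N in atTop, ENNReal.ofReal (cantorBeta s N) < ε := by
    have h := ENNReal.tendsto_ofReal (tendsto_cantorBeta s.2)
    rw [ENNReal.ofReal_zero] at h
    exact h.eventually (gt_mem_nhds hε)
  -- `N` is fixed from the limit point `s` alone; for this `N` the bound tends to `cantorBeta s N`,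
  -- which is below `ε`, as `r` tends to `s`.
  obtain ⟨N, hN⟩ := hev.exists
  have hc : ContinuousAt (fun r : Set.Ioi (1 : ℝ) => ENNReal.ofReal
      ((min (r : ℝ) s)⁻¹ ^ N / 2 + (1 - (min (r : ℝ) s / max (r : ℝ) s) ^ N))) s := by
    refine ENNReal.continuous_ofReal.continuousAt.comp ?_
    have hmin : ContinuousAt (fun r : Set.Ioi (1 : ℝ) => min (r : ℝ) s) s := by fun_prop
    have hmax : ContinuousAt (fun r : Set.Ioi (1 : ℝ) => max (r : ℝ) s) s := by fun_prop
    exact (((hmin.inv₀ (by simpa using hs0.ne')).pow N).div_const 2).add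
      (continuousAt_const.sub ((hmin.div hmax (by simpa using hs0.ne')).pow N))
  have hlt : ENNReal.ofReal ((min (s : ℝ) s)⁻¹ ^ N / 2 + (1 - (min (s : ℝ) s / max (s : ℝ) s) ^ N))
      < ε := by
    rwa [min_self, max_self, div_self hs0.ne', one_pow, sub_self, add_zero, ← cantorBeta_eq]
  filter_upwards [hc.eventually (gt_mem_nhds hlt)] with r hr
  exact (edist_cantor_le_min_max r.2 s.2 N).trans_lt hr

end QuantumMetric

theorem mainTheorem11 :
    (∀ n : ℕ, ∃! E : C(Cantor, ℂ) →L[ℂ] C(Cantor, ℂ), IsCondExp cantorTrace (cantorAlg n) E) ∧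
    ∃ h : ∀ r : Set.Ioi (1 : ℝ), IsQQCMS 2 0 C(Cantor, ℂ) (cantorLip r),
      Continuous (fun r : Set.Ioi (1 : ℝ) =>
        (⟨C(Cantor, ℂ), cantorLip r, h r⟩ : QQCMS 2 0)) :=
  ⟨fun n => ⟨cantorExp n, isCondExp_cantorExp n, fun _ hE => hE.eq_cantorExp⟩,
    fun r => isQQCMS_cantorLip r.2, continuous_cantor_propinquity⟩
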